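/- Let $X$ be a locally compact metrisable space, let $d\ge 0$ be an integer, and let $\Phi=\{\phi_{\mathbf n}:\mathbf n\in\mathbb Z_+^d\}$ be an action of the additive semigroup $\mathbb Z_+^d$ on $X$ by continuous proper surjections: $\phi_{\mathbf 0}=\mathrm{id}$ and $\phi_{\mathbf m+\mathbf n}=\phi_{\mathbf m}\circ\phi_{\mathbf n}$. For $f\in C_0(X)$ (complex-valued) put $\alpha_{\mathbf n}(f)=f\circ\phi_{\mathbf n}$. Let $\rho$ be a faithful $*$-representation of $C_0(X)$ on a complex Hilbert space $H$. For $\mathbf n\in\mathbb Z_+^d$ and $f\in C_0(X)$ let the monomial $U_{\mathbf n}f$ denote the bounded operator on $H\otimes\ell^2(\mathbb Z_+^d)$ given by $$U_{\mathbf n}f\,(\xi\otimes e_{\mathbf k})=\rho(\alpha_{\mathbf k}(f))\xi\otimes e_{\mathbf k+\mathbf n}.$$ The analytic crossed product $\mathcal A=C_0(X)\times_\phi\mathbb Z_+^d$ is the operator-norm closure of the set of all sums $\sum_{\mathbf n}U_{\mathbf n}f_{\mathbf n}$ with $f_{\mathbf n}\in C_0(X)$ and $\sum_{\mathbf n}\|f_{\mathbf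 n}\|<\infty$. It is a (not necessarily unital) Banach algebra. For $J\subseteq\{1,\dots,d\}$, a point $x\in X$ is $J$-recurrent if there is a sequence $(\mathbf n_k)$ in $\mathbb Z_+^d$ such that, for each $j\in J$, the $j$-th entries of $\mathbf n_k$ are strictly increasing in $k$, and $\phi_{\mathbf n_k}(x)\to x$. Let $X_{Jr}$ be the set of $J$-recurrent points. Let $\mathrm{Rad}\,\mathcal A$ (the Jacobson radical) be the intersection of all primitive ideals of $\mathcal A$, i.e. of all kernels of algebraically irreducible representations of $\mathcal A$, and let $\mathrm{PRad}\,\mathcal A$ (the prime radical) be the intersection of all prime ideals of $\mathcal A$; here ideals are two-sided, and an intersection over the empty family is $\mathcal A$. Then $\mathrm{Rad}\,\mathcal A$ is the closed two-sided ideal of $\mathcal A$ generated by all monomials $U_{\mathbf n}f$ with $\mathbf n\neq\mathbf 0$ such that $f$ vanishes on $X_{Jr}$, where $J=\{j:\mathbf n_j\ne 0\}$ is the support of $\mathbf n$. Moreover, $\mathrm{PRad}\,\mathcal A=\mathrm{Rad}\,\mathcal A$ if and only if $\mathrm{PRad}\,\mathcal A$ is closed. -/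

import Mathlib

open Filter Topology
open scoped ENNReal ZeroAtInfty

noncomputable section

/-! ## Ideals and radicals of a (not necessarily unital) complex algebra -/

namespace AlgRad

variable {A : Type*} [NonUnitalRing A] [Module ℂ A]

/-- A linear subspace that absorbs multiplication on both sides: a two-sided algebra ideal. -/
def IsTwoSidedIdeal (I : Submodule ℂ A) : Prop :=
  ∀ a : A, ∀ x ∈ I, a * x ∈ I ∧ x * a ∈ I

/-- Algebraic irreducibility of a representation on a complex vector space: it is not the zero
representation, and its only invariant subspaces are `0` and the whole space. -/
def IsIrreducibleRep {V : Type*} [AddCommGroup V] [Module ℂ V]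
    (π : A →ₙₐ[ℂ] Module.End ℂ V) : Prop :=
  (∃ a, π a ≠ 0) ∧
    ∀ W : Submodule ℂ V, (∀ a, ∀ w ∈ W, π a w ∈ W) → W = ⊥ ∨ W = ⊤

/-- A primitive ideal: the kernel of an algebraically irreducible representation. Up to
isomorphism, every irreducible representation of `A` acts on a quotient of `A`, so representation
spaces in the universe of `A` suffice. -/
def IsPrimitiveIdeal.{w} {A : Type w} [NonUnitalRing A] [Module ℂ A] (I : Submodule ℂ A) : Prop :=
  ∃ (V : Type w) (_ : AddCommGroup V) (_ : Module ℂ V) (π : A →ₙₐ[ℂ] Module.End ℂ V),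
    IsIrreducibleRep π ∧ ∀ a, a ∈ I ↔ π a = 0

/-- A prime ideal: a two-sided ideal containing a product of two ideals only if it contains one of
the factors. The whole algebra is not excluded; this does not affect intersections. -/
def IsPrimeIdeal (P : Submodule ℂ A) : Prop :=
  IsTwoSidedIdeal P ∧
    ∀ I J : Submodule ℂ A, IsTwoSidedIdeal I → IsTwoSidedIdeal J →
      (∀ x ∈ I, ∀ y ∈ J, x * y ∈ P) → I ≤ P ∨ J ≤ P

variable (A) in
/-- The Jacobson radical: the intersection of all primitive ideals (`⊤` if there are none). -/
def jacobsonRadical : Submodule ℂ A :=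
  sInf {I | IsPrimitiveIdeal I}

variable (A) in
/-- The prime radical: the intersection of all prime ideals. -/
def primeRadical : Submodule ℂ A :=
  sInf {P | IsPrimeIdeal P}

/-- The closed two-sided ideal generated by a set. -/
def closedIdealGenerated [TopologicalSpace A] (S : Set A) : Submodule ℂ A :=
  sInf {I | IsTwoSidedIdeal I ∧ IsClosed (I : Set A) ∧ S ⊆ I}

end AlgRad

/-- An action of the additive semigroup `ℤ₊ᵈ` on `X` by continuous proper surjections
(`IsProperMap` includes continuity). -/
structure DynSystem (d : ℕ) (X : Type*) [TopologicalSpace X] where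
  /-- the maps of the action -/
  φ : (Fin d → ℕ) → X → X
  φ_zero : φ 0 = id
  φ_add : ∀ m n, φ (m + n) = φ m ∘ φ n
  proper : ∀ n, IsProperMap (φ n)
  surjective : ∀ n, Function.Surjective (φ n)

namespace DynSystem

universe u v

variable {d : ℕ} {X : Type u} [TopologicalSpace X]

/-- The set of `J`-recurrent points: `x` is the limit of `φ_{p k} x` for some sequence `p` of
multi-indices that is strictly increasing in every direction `j ∈ J`. -/
def recurrentPts (Φ : DynSystem d X) (J : Set (Fin d)) : Set X :=
  {x | ∃ p : ℕ → (Fin d → ℕ), (∀ j ∈ J, StrictMono fun k => p k j) ∧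
    Tendsto (fun k => Φ.φ (p k) x) atTop (𝓝 x)}

variable [T2Space X] [LocallyCompactSpace X]

/-- The map `φ n`, bundled as a cocompact map. -/
def cocompactMap (Φ : DynSystem d X) (n : Fin d → ℕ) : CocompactMap X X where
  toFun := Φ.φ n
  continuous_toFun := (Φ.proper n).continuous
  cocompact_tendsto' := (isProperMap_iff_tendsto_cocompact.mp (Φ.proper n)).2

/-- The endomorphism `α n f = f ∘ φ n` of `C₀(X)`. -/
def α (Φ : DynSystem d X) (n : Fin d → ℕ) (f : C₀(X, ℂ)) : C₀(X, ℂ) :=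
  f.comp (Φ.cocompactMap n)

@[simp] theorem α_apply (Φ : DynSystem d X) (n : Fin d → ℕ) (f : C₀(X, ℂ)) (x : X) :
    Φ.α n f x = f (Φ.φ n x) := rfl

theorem norm_α_le (Φ : DynSystem d X) (n : Fin d → ℕ) (f : C₀(X, ℂ)) : ‖Φ.α n f‖ ≤ ‖f‖ := by
  rw [← ZeroAtInftyContinuousMap.norm_toBCF_eq_norm, ← ZeroAtInftyContinuousMap.norm_toBCF_eq_norm]
  exact (BoundedContinuousFunction.norm_le (norm_nonneg _)).2 fun x =>
    f.toBCF.norm_coe_le_norm (Φ.φ n x)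

variable {H : Type v} [NormedAddCommGroup H] [InnerProductSpace ℂ H] [CompleteSpace H]

/-- The Hilbert space `H ⊗ ℓ²(ℤ₊ᵈ)`, realised as the square-summable families in `H` indexed by
`ℤ₊ᵈ`; `ξ ⊗ e_k` is the family with value `ξ` at `k` and `0` elsewhere. -/
abbrev FockSpace (d : ℕ) (H : Type v) [NormedAddCommGroup H] : Type v :=
  lp (fun _ : Fin d → ℕ => H) 2

open scoped Classical in
/-- The family of vectors underlying `π(U_n f) ξ`. -/
def monomialFun (Φ : DynSystem d X) (ρ : C₀(X, ℂ) →⋆ₙₐ[ℂ] (H →L[ℂ] H)) (n : Fin d → ℕ)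
    (f : C₀(X, ℂ)) (ξ : (Fin d → ℕ) → H) (k : Fin d → ℕ) : H :=
  if n ≤ k then ρ (Φ.α (k - n) f) (ξ (k - n)) else 0

theorem norm_rep_apply_le (Φ : DynSystem d X) (ρ : C₀(X, ℂ) →⋆ₙₐ[ℂ] (H →L[ℂ] H))
    (n : Fin d → ℕ) (f : C₀(X, ℂ)) (x : H) : ‖ρ (Φ.α n f) x‖ ≤ ‖f‖ * ‖x‖ :=
  ((ρ (Φ.α n f)).le_opNorm x).trans <| mul_le_mul_of_nonneg_right
    ((NonUnitalStarAlgHom.norm_apply_le ρ _).trans (Φ.norm_α_le n f)) (norm_nonneg _)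

theorem sum_monomialFun_le (Φ : DynSystem d X) (ρ : C₀(X, ℂ) →⋆ₙₐ[ℂ] (H →L[ℂ] H))
    (n : Fin d → ℕ) (f : C₀(X, ℂ)) (ξ : FockSpace d H) (s : Finset (Fin d → ℕ)) :
    ∑ k ∈ s, ‖monomialFun Φ ρ n f ξ k‖ ^ (2 : ℝ≥0∞).toReal
      ≤ (‖f‖ * ‖ξ‖) ^ (2 : ℝ≥0∞).toReal := by
  classical
  have h2 : (0 : ℝ) < (2 : ℝ≥0∞).toReal := by norm_num
  calc ∑ k ∈ s, ‖monomialFun Φ ρ n f ξ k‖ ^ (2 : ℝ≥0∞).toReal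
      = ∑ k ∈ s.filter (fun k => n ≤ k),
          ‖ρ (Φ.α (k - n) f) (ξ (k - n))‖ ^ (2 : ℝ≥0∞).toReal := by
        rw [Finset.sum_filter]
        refine Finset.sum_congr rfl fun k _ => ?_
        unfold monomialFun
        split_ifs <;> simp
    _ ≤ ∑ k ∈ s.filter (fun k => n ≤ k),
          ‖f‖ ^ (2 : ℝ≥0∞).toReal * ‖ξ (k - n)‖ ^ (2 : ℝ≥0∞).toReal := by
        refine Finset.sum_le_sum fun k _ => ?_
        rw [← Real.mul_rpow (norm_nonneg _) (norm_nonneg _)]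
        exact Real.rpow_le_rpow (norm_nonneg _) (Φ.norm_rep_apply_le ρ _ f _) h2.le
    _ = ‖f‖ ^ (2 : ℝ≥0∞).toReal * ∑ k ∈ (s.filter (fun k => n ≤ k)).image (fun k => k - n),
          ‖ξ k‖ ^ (2 : ℝ≥0∞).toReal := by
        rw [Finset.sum_image, Finset.mul_sum]
        intro a ha b hb hab
        have ha' : n ≤ a := (Finset.mem_filter.1 ha).2
        have hb' : n ≤ b := (Finset.mem_filter.1 hb).2
        rw [← tsub_add_cancel_of_le ha', ← tsub_add_cancel_of_le hb']
        exact congrArg (· + n) hab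
    _ ≤ ‖f‖ ^ (2 : ℝ≥0∞).toReal * ‖ξ‖ ^ (2 : ℝ≥0∞).toReal :=
        mul_le_mul_of_nonneg_left (lp.sum_rpow_le_norm_rpow h2 ξ _)
          (Real.rpow_nonneg (norm_nonneg _) _)
    _ = _ := (Real.mul_rpow (norm_nonneg _) (norm_nonneg _)).symm

/-- The operator `π(U_n f)` on `H ⊗ ℓ²(ℤ₊ᵈ)`, determined by
`π(U_n f) (ξ ⊗ e_k) = ρ (α_k f) ξ ⊗ e_{k + n}`. -/
def monomialOp (Φ : DynSystem d X) (ρ : C₀(X, ℂ) →⋆ₙₐ[ℂ] (H →L[ℂ] H)) (n : Fin d → ℕ)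
    (f : C₀(X, ℂ)) : FockSpace d H →L[ℂ] FockSpace d H :=
  LinearMap.mkContinuous
    { toFun := fun ξ => ⟨monomialFun Φ ρ n f ξ, memℓp_gen' (Φ.sum_monomialFun_le ρ n f ξ)⟩
      map_add' := fun ξ η => by
        ext k
        change monomialFun Φ ρ n f (ξ + η : FockSpace d H) k = monomialFun Φ ρ n f ξ k + monomialFun Φ ρ n f η k
        unfold monomialFun
        split_ifs
        · exact map_add (ρ (Φ.α (k - n) f)) (ξ (k - n)) (η (k - n))
        · simp
      map_smul' := fun c ξ => by
        ext k
        change monomialFun Φ ρ n f (c • ξ : FockSpace d H) k = c • monomialFun Φ ρ n f ξ k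
        unfold monomialFun
        split_ifs
        · exact map_smul (ρ (Φ.α (k - n) f)) c (ξ (k - n))
        · simp }
    ‖f‖
    (fun ξ => lp.norm_le_of_forall_sum_le (by norm_num) (by positivity)
      (Φ.sum_monomialFun_le ρ n f ξ))

open scoped Classical in
theorem monomialOp_apply (Φ : DynSystem d X) (ρ : C₀(X, ℂ) →⋆ₙₐ[ℂ] (H →L[ℂ] H))
    (n : Fin d → ℕ) (f : C₀(X, ℂ)) (ξ : FockSpace d H) (k : Fin d → ℕ) :
    Φ.monomialOp ρ n f ξ k = if n ≤ k then ρ (Φ.α (k - n) f) (ξ (k - n)) else 0 := rfl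

/-- The defining formula `π(U_n f) (ξ ⊗ e_k) = ρ (α_k f) ξ ⊗ e_{k + n}`. -/
theorem monomialOp_single (Φ : DynSystem d X) (ρ : C₀(X, ℂ) →⋆ₙₐ[ℂ] (H →L[ℂ] H))
    (n : Fin d → ℕ) (f : C₀(X, ℂ)) (ξ : H) (k : Fin d → ℕ) :
    Φ.monomialOp ρ n f (lp.single 2 k ξ) = lp.single 2 (k + n) (ρ (Φ.α k f) ξ) := by
  ext i
  rw [monomialOp_apply]
  by_cases hi : i = k + n
  · subst hi
    simp
  · rw [lp.single_apply_ne _ _ _ hi]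
    split_ifs with h
    · rw [lp.single_apply_ne, map_zero]
      rintro rfl
      exact hi (tsub_add_cancel_of_le h).symm
    · rfl

theorem norm_monomialOp_le (Φ : DynSystem d X) (ρ : C₀(X, ℂ) →⋆ₙₐ[ℂ] (H →L[ℂ] H))
    (n : Fin d → ℕ) (f : C₀(X, ℂ)) : ‖Φ.monomialOp ρ n f‖ ≤ ‖f‖ :=
  LinearMap.mkContinuous_norm_le _ (norm_nonneg _) _

/-- The multiplication rule `U_n f U_m g = U_{n+m} (α_m f · g)`. -/
theorem monomialOp_mul (Φ : DynSystem d X) (ρ : C₀(X, ℂ) →⋆ₙₐ[ℂ] (H →L[ℂ] H))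
    (n m : Fin d → ℕ) (f g : C₀(X, ℂ)) :
    Φ.monomialOp ρ n f * Φ.monomialOp ρ m g = Φ.monomialOp ρ (n + m) (Φ.α m f * g) := by
  ext ξ k
  rw [mul_apply_eq_comp, monomialOp_apply, monomialOp_apply, monomialOp_apply]
  by_cases h : n + m ≤ k
  · have hn : n ≤ k := le_self_add.trans h
    have hm : m ≤ k - n := le_tsub_of_add_le_left h
    have e : k - n = m + (k - (n + m)) := by
      rw [← tsub_tsub, add_tsub_cancel_of_le hm]
    have e2 : Φ.α (k - (n + m)) (Φ.α m f * g) = Φ.α (k - n) f * Φ.α (k - (n + m)) g := by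
      ext x
      rw [e, ZeroAtInftyContinuousMap.mul_apply]
      simp [Φ.φ_add]
    rw [if_pos hn, if_pos hm, if_pos h, e2, map_mul, tsub_tsub]
    rfl
  · rw [if_neg h]
    split_ifs with hn hm
    · exact absurd (add_comm m n ▸ (le_tsub_iff_right hn).1 hm) h
    · simp
    · rfl

/-- The representation of `ℓ¹(ℤ₊ᵈ, C₀(X))` on `H ⊗ ℓ²(ℤ₊ᵈ)`: the formal series `∑ U_n f_n` is sent
to the (absolutely convergent) sum of the operators `π(U_n f_n)`. -/
def ell1Rep (Φ : DynSystem d X) (ρ : C₀(X, ℂ) →⋆ₙₐ[ℂ] (H →L[ℂ] H))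
    (F : lp (fun _ : Fin d → ℕ => C₀(X, ℂ)) 1) : FockSpace d H →L[ℂ] FockSpace d H :=
  ∑' n, Φ.monomialOp ρ n (F n)

theorem summable_ell1Rep (Φ : DynSystem d X) (ρ : C₀(X, ℂ) →⋆ₙₐ[ℂ] (H →L[ℂ] H))
    (F : lp (fun _ : Fin d → ℕ => C₀(X, ℂ)) 1) : Summable fun n => Φ.monomialOp ρ n (F n) := by
  have h : Summable fun n => ‖F n‖ := by
    simpa using (lp.memℓp F).summable (by norm_num)
  exact Summable.of_norm_bounded h fun n => Φ.norm_monomialOp_le ρ n (F n)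

theorem ell1Rep_single (Φ : DynSystem d X) (ρ : C₀(X, ℂ) →⋆ₙₐ[ℂ] (H →L[ℂ] H))
    (n : Fin d → ℕ) (f : C₀(X, ℂ)) :
    Φ.ell1Rep ρ (lp.single 1 n f) = Φ.monomialOp ρ n f := by
  have h0 : ∀ m, Φ.monomialOp ρ m (0 : C₀(X, ℂ)) = 0 := fun m =>
    norm_le_zero_iff.1 ((Φ.norm_monomialOp_le ρ m 0).trans_eq norm_zero)
  unfold ell1Rep
  rw [tsum_eq_single n, lp.single_apply_self]
  intro m hm
  rw [lp.single_apply_ne _ _ _ hm, h0]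

/-- The trigonometric polynomials: finite sums of monomials. -/
def polys (Φ : DynSystem d X) (ρ : C₀(X, ℂ) →⋆ₙₐ[ℂ] (H →L[ℂ] H)) :
    Submodule ℂ (FockSpace d H →L[ℂ] FockSpace d H) :=
  Submodule.span ℂ {T | ∃ n f, T = Φ.monomialOp ρ n f}

theorem polys_mul_mem (Φ : DynSystem d X) (ρ : C₀(X, ℂ) →⋆ₙₐ[ℂ] (H →L[ℂ] H))
    {S T : FockSpace d H →L[ℂ] FockSpace d H} (hS : S ∈ Φ.polys ρ) (hT : T ∈ Φ.polys ρ) :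
    S * T ∈ Φ.polys ρ := by
  induction hS, hT using Submodule.span_induction₂ with
  | mem_mem x y hx hy =>
    obtain ⟨n, f, rfl⟩ := hx
    obtain ⟨m, g, rfl⟩ := hy
    exact Submodule.subset_span ⟨_, _, Φ.monomialOp_mul ρ n m f g⟩
  | zero_left y hy => simp
  | zero_right x hx => simp
  | add_left x y z _ _ _ h₁ h₂ => rw [add_mul]; exact add_mem h₁ h₂
  | add_right x y z _ _ _ h₁ h₂ => rw [mul_add]; exact add_mem h₁ h₂
  | smul_left r x y _ _ h => rw [smul_mul_assoc]; exact Submodule.smul_mem _ _ h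
  | smul_right r x y _ _ h => rw [mul_smul_comm]; exact Submodule.smul_mem _ _ h

theorem range_ell1Rep_subset (Φ : DynSystem d X) (ρ : C₀(X, ℂ) →⋆ₙₐ[ℂ] (H →L[ℂ] H)) :
    Set.range (Φ.ell1Rep ρ) ⊆ closure (Φ.polys ρ : Set (FockSpace d H →L[ℂ] FockSpace d H)) := by
  rintro _ ⟨F, rfl⟩
  refine mem_closure_of_tendsto (Φ.summable_ell1Rep ρ F).hasSum (Eventually.of_forall fun s => ?_)
  exact Submodule.sum_mem _ fun n _ => Submodule.subset_span ⟨_, _, rfl⟩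

/-- The image of the `ℓ¹`-algebra and the trigonometric polynomials have the same closure. -/
theorem closure_range_ell1Rep (Φ : DynSystem d X) (ρ : C₀(X, ℂ) →⋆ₙₐ[ℂ] (H →L[ℂ] H)) :
    closure (Set.range (Φ.ell1Rep ρ)) =
      closure (Φ.polys ρ : Set (FockSpace d H →L[ℂ] FockSpace d H)) := by
  refine (closure_minimal (Φ.range_ell1Rep_subset ρ) isClosed_closure).antisymm
    (closure_mono fun T hT => ?_)
  have hsm : ∀ n (c : ℂ) (f : C₀(X, ℂ)), c • Φ.monomialOp ρ n f = Φ.monomialOp ρ n (c • f) := by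
    intro n c f
    ext ξ k
    have e : Φ.α (k - n) (c • f) = c • Φ.α (k - n) f := rfl
    change c • (Φ.monomialOp ρ n f ξ k) = Φ.monomialOp ρ n (c • f) ξ k
    rw [monomialOp_apply, monomialOp_apply, e, map_smul]
    split_ifs <;> simp
  have had : ∀ n (f g : C₀(X, ℂ)),
      Φ.monomialOp ρ n (f + g) = Φ.monomialOp ρ n f + Φ.monomialOp ρ n g := by
    intro n f g
    ext ξ k
    have e : Φ.α (k - n) (f + g) = Φ.α (k - n) f + Φ.α (k - n) g := rfl
    change _ = Φ.monomialOp ρ n f ξ k + Φ.monomialOp ρ n g ξ k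
    rw [monomialOp_apply, monomialOp_apply, monomialOp_apply, e, map_add]
    split_ifs <;> simp
  change T ∈ Submodule.span ℂ _ at hT
  induction hT using Submodule.span_induction with
  | mem x hx =>
    obtain ⟨n, f, rfl⟩ := hx
    exact ⟨_, Φ.ell1Rep_single ρ n f⟩
  | zero => exact ⟨lp.single 1 0 0, by
      rw [ell1Rep_single]
      simpa using (hsm 0 0 0).symm⟩
  | add x y _ _ hx hy =>
    obtain ⟨F, rfl⟩ := hx
    obtain ⟨G, rfl⟩ := hy
    refine ⟨F + G, ?_⟩
    unfold ell1Rep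
    rw [← (Φ.summable_ell1Rep ρ F).tsum_add (Φ.summable_ell1Rep ρ G)]
    exact tsum_congr fun n => had n (F n) (G n)
  | smul c x _ hx =>
    obtain ⟨F, rfl⟩ := hx
    refine ⟨c • F, ?_⟩
    unfold ell1Rep
    rw [← (Φ.summable_ell1Rep ρ F).tsum_const_smul c]
    exact tsum_congr fun n => (hsm n c (F n)).symm

/-- The analytic crossed product `C₀(X) ×_φ ℤ₊ᵈ`: the closure in `B(H ⊗ ℓ²(ℤ₊ᵈ))` of the image of
`ℓ¹(ℤ₊ᵈ, C₀(X))`, as a (not necessarily unital) algebra of operators with the operator norm. -/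
def crossedProduct (Φ : DynSystem d X) (ρ : C₀(X, ℂ) →⋆ₙₐ[ℂ] (H →L[ℂ] H)) :
    NonUnitalSubalgebra ℂ (FockSpace d H →L[ℂ] FockSpace d H) where
  carrier := closure (Set.range (Φ.ell1Rep ρ))
  add_mem' {S T} hS hT := by
    rw [closure_range_ell1Rep] at *
    exact (Φ.polys ρ).topologicalClosure.add_mem hS hT
  zero_mem' := by
    rw [closure_range_ell1Rep]
    exact (Φ.polys ρ).topologicalClosure.zero_mem
  smul_mem' c T hT := by
    rw [closure_range_ell1Rep] at *
    exact (Φ.polys ρ).topologicalClosure.smul_mem c hT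
  mul_mem' {S T} hS hT := by
    rw [closure_range_ell1Rep] at *
    exact map_mem_closure₂ continuous_mul hS hT fun _ h₁ _ h₂ => Φ.polys_mul_mem ρ h₁ h₂

/-- The monomial `U_n f` as an element of the analytic crossed product. -/
def monomial (Φ : DynSystem d X) (ρ : C₀(X, ℂ) →⋆ₙₐ[ℂ] (H →L[ℂ] H)) (n : Fin d → ℕ)
    (f : C₀(X, ℂ)) : Φ.crossedProduct ρ :=
  ⟨Φ.monomialOp ρ n f, subset_closure ⟨_, Φ.ell1Rep_single ρ n f⟩⟩

end DynSystem

end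

/-!
The Jacobson radical of a Banach algebra is closed and invariant under automorphisms. The gauge
automorphisms `U_n f ↦ z ^ n U_n f` of the crossed product therefore reduce the computation of the
radical to monomials: the Fourier term `U_n f_n` of an element `a` is a limit of averages of gauge
images of `a` (`FourierAlgebra.term_mem`), and `a` is the norm limit of the Abel means of its
Fourier series (`FourierAlgebra.mem_of_term_mem`), which are contractive by the maximum principle.

*Monomials that belong to the radical.* Let `I` be a closed semiprime ideal, meaning that
`a A a ⊆ I` forces `a ∈ I`. The functions `f` with `U_n f ∈ I` form a closed ideal of `C₀(X)`, and by
semiprimeness its hull `Y` does not change when `n` is replaced by a positive multiple. If no point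
of an open piece `V ∩ Y` returned to `V` at late times in the directions of `n`, every `f` supported
in `V` would satisfy `(U_n' f) A (U_n' f) ⊆ I` for a large multiple `n'` of `n`, and hence vanish on
`Y`. So every piece of `Y` returns (`FourierAlgebra.exists_return`), and a nested ball argument
shows that `Y` lies in the closure of the recurrent points
(`DynSystem.subset_closure_recurrentPts`). Consequently `U_n f ∈ I` as soon as `f` vanishes on the
points recurrent in the directions of `n`. This applies to the Jacobson radical, and to the prime
radical when it is closed; since the prime radical is always contained in the Jacobson radical, the
second assertion follows from the first.

*Monomials that do not.* If `U_n f` is in the radical and `f x ≠ 0` at a recurrent point `x`, one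
forms `B = ∑ 2 ^ -(k+1) U_{r_k} h` in the ideal generated by `U_n f`, where `h ≥ 0` is a function
with `h x > 1`. All Fourier coefficients involved are nonnegative, so no cancellation occurs, and a
norm of a power of `B` is bounded below by the contribution of a single word in the `r_k`. The
palindromic words `W_{k+1} = W_k r_{k+1} W_k` use `r_k` with frequency about `2 ^ -(k+1)`, so the
weights contribute only a geometric factor, and the `r_k` are chosen by means of return times of `x`
so that the values of `h` along the orbit of `x` have product greater than `1`
(`DynSystem.exists_dyadic_scheme`). Thus `B` is not quasi-nilpotent, contrary to a general property of the radical (`AlgRad.exists_norm_dyadicPow_lt`).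
-/

/-! ### Radicals of complex algebras -/

namespace AlgRad

section Algebra

variable {A : Type*} [NonUnitalRing A] [Module ℂ A]

/-- The elementwise form of semiprimeness: `a A a ⊆ I` forces `a ∈ I`. -/
def IsSemiprime (I : Submodule ℂ A) : Prop :=
  ∀ a, (∀ b, a * b * a ∈ I) → a ∈ I

theorem IsSemiprime.sInf {S : Set (Submodule ℂ A)} (h : ∀ I ∈ S, IsSemiprime I) :
    IsSemiprime (sInf S) := fun a ha =>
  Submodule.mem_sInf.2 fun I hI => h I hI a fun b => Submodule.mem_sInf.1 (ha b) I hI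

theorem IsTwoSidedIdeal.sInf {S : Set (Submodule ℂ A)} (h : ∀ I ∈ S, IsTwoSidedIdeal I) :
    IsTwoSidedIdeal (sInf S) := fun a x hx =>
  ⟨Submodule.mem_sInf.2 fun I hI => (h I hI a x (Submodule.mem_sInf.1 hx I hI)).1,
    Submodule.mem_sInf.2 fun I hI => (h I hI a x (Submodule.mem_sInf.1 hx I hI)).2⟩

/-- An irreducible representation acts transitively on nonzero vectors. -/
theorem IsIrreducibleRep.exists_apply_eq {V : Type*} [AddCommGroup V] [Module ℂ V]
    {π : A →ₙₐ[ℂ] Module.End ℂ V} (hπ : IsIrreducibleRep π) {w : V} (hw : w ≠ 0) (v : V) :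
    ∃ a, π a w = v := by
  obtain ⟨⟨a₀, ha₀⟩, h⟩ := hπ
  have key : ∃ a, π a w ≠ 0 := by
    by_contra! hc
    let W : Submodule ℂ V :=
      { carrier := {u | ∀ a, π a u = 0}
        add_mem' := fun {x y} hx hy a => by rw [map_add, hx a, hy a, add_zero]
        zero_mem' := fun a => map_zero _
        smul_mem' := fun c x hx a => by rw [map_smul, hx a, smul_zero] }
    rcases h W (fun a u hu b => by rw [hu a, map_zero]) with hW | hW
    · exact hw ((Submodule.mem_bot ℂ).1 (hW ▸ (show w ∈ W from hc)))
    · refine ha₀ (LinearMap.ext fun u => ?_)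
      have hu : u ∈ W := hW ▸ Submodule.mem_top
      exact hu a₀
  obtain ⟨a₁, ha₁⟩ := key
  let W : Submodule ℂ V :=
    { carrier := {u | ∃ a, π a w = u}
      add_mem' := by
        rintro _ _ ⟨a, rfl⟩ ⟨b, rfl⟩
        exact ⟨a + b, by rw [map_add, LinearMap.add_apply]⟩
      zero_mem' := ⟨0, by rw [map_zero, LinearMap.zero_apply]⟩
      smul_mem' := by
        rintro c _ ⟨a, rfl⟩
        exact ⟨c • a, by rw [map_smul, LinearMap.smul_apply]⟩ }
  rcases h W (by
      rintro a _ ⟨b, rfl⟩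
      exact ⟨a * b, by rw [map_mul, Module.End.mul_apply]⟩) with hW | hW
  · exact absurd ((Submodule.mem_bot ℂ).1 (hW ▸ (show π a₁ w ∈ W from ⟨a₁, rfl⟩))) ha₁
  · exact (hW ▸ Submodule.mem_top : v ∈ W)

theorem IsIrreducibleRep.comp {B V : Type*} [NonUnitalRing B] [Module ℂ B] [AddCommGroup V]
    [Module ℂ V] {π : A →ₙₐ[ℂ] Module.End ℂ V} (hπ : IsIrreducibleRep π) (θ : B →ₙₐ[ℂ] A)
    (hθ : Function.Surjective θ) : IsIrreducibleRep (π.comp θ) := by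
  obtain ⟨⟨a, ha⟩, h⟩ := hπ
  obtain ⟨b, rfl⟩ := hθ a
  refine ⟨⟨b, ha⟩, fun W hW => h W fun a w hw => ?_⟩
  obtain ⟨b, rfl⟩ := hθ a
  exact hW b w hw

theorem IsPrimitiveIdeal.isTwoSidedIdeal {P : Submodule ℂ A} (hP : IsPrimitiveIdeal P) :
    IsTwoSidedIdeal P := by
  obtain ⟨V, _, _, π, -, h⟩ := hP
  intro a x hx
  rw [h] at hx
  rw [h, h, map_mul, map_mul, hx, mul_zero, zero_mul]
  exact ⟨rfl, rfl⟩

theorem IsPrimitiveIdeal.isPrimeIdeal {P : Submodule ℂ A} (hP : IsPrimitiveIdeal P) :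
    IsPrimeIdeal P := by
  refine ⟨hP.isTwoSidedIdeal, fun I J _ hJ hIJ => ?_⟩
  obtain ⟨V, _, _, π, hπ, h⟩ := hP
  by_contra! hc
  obtain ⟨⟨i, hi, hiP⟩, ⟨j, hj, hjP⟩⟩ :=
    And.intro (SetLike.not_le_iff_exists.1 hc.1) (SetLike.not_le_iff_exists.1 hc.2)
  rw [h] at hiP hjP
  obtain ⟨v, hv⟩ : ∃ v, π j v ≠ 0 := by
    by_contra! h0
    exact hjP (LinearMap.ext h0)
  refine hiP (LinearMap.ext fun w => ?_)
  obtain ⟨b, rfl⟩ := hπ.exists_apply_eq hv w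
  have := (h _).1 (hIJ i hi (b * j) (hJ b j hj).1)
  rw [map_mul, map_mul] at this
  simpa using LinearMap.congr_fun this v

theorem primeRadical_isTwoSidedIdeal : IsTwoSidedIdeal (primeRadical A) :=
  IsTwoSidedIdeal.sInf fun _ h => h.1

theorem jacobsonRadical_isTwoSidedIdeal : IsTwoSidedIdeal (jacobsonRadical A) :=
  IsTwoSidedIdeal.sInf fun _ h => IsPrimitiveIdeal.isTwoSidedIdeal h

theorem primeRadical_le_jacobsonRadical : primeRadical A ≤ jacobsonRadical A :=
  sInf_le_sInf fun _ h => IsPrimitiveIdeal.isPrimeIdeal h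

theorem map_mem_jacobsonRadical (θ : A →ₙₐ[ℂ] A) (hθ : Function.Surjective θ) {a : A}
    (ha : a ∈ jacobsonRadical A) : θ a ∈ jacobsonRadical A := by
  refine Submodule.mem_sInf.2 ?_
  rintro P ⟨V, _, _, π, hπ, h⟩
  rw [h]
  let K : Submodule ℂ A :=
    { carrier := {b | π (θ b) = 0}
      add_mem' := fun {x y} hx hy => by
        change π (θ (x + y)) = 0
        rw [map_add, map_add, hx, hy, add_zero]
      zero_mem' := by change π (θ 0) = 0; rw [map_zero, map_zero]
      smul_mem' := fun c x hx => by
        change π (θ (c • x)) = 0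
        rw [map_smul, map_smul, hx, smul_zero] }
  exact Submodule.mem_sInf.1 ha K ⟨V, _, _, π.comp θ, hπ.comp θ hθ, fun b => Iff.rfl⟩

variable [IsScalarTower ℂ A A] [SMulCommClass ℂ A A]

/-- In the absence of a unit, the definition of primeness is applied to colon ideals of `P` rather
than to principal ideals. -/
theorem IsPrimeIdeal.isSemiprime {P : Submodule ℂ A} (hP : IsPrimeIdeal P) : IsSemiprime P := by
  obtain ⟨hP, hprime⟩ := hP
  intro a ha
  let C : Submodule ℂ A :=
    { carrier := {x | ∀ b, b * x ∈ P}
      add_mem' := fun {x y} hx hy b => by rw [mul_add]; exact add_mem (hx b) (hy b)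
      zero_mem' := fun b => by rw [mul_zero]; exact zero_mem _
      smul_mem' := fun c x hx b => by rw [mul_smul_comm]; exact P.smul_mem c (hx b) }
  have hC : IsTwoSidedIdeal C := fun b x hx =>
    ⟨fun e => by rw [← mul_assoc]; exact hx _,
      fun e => by rw [← mul_assoc]; exact (hP b _ (hx e)).2⟩
  have hCP : C ≤ P := by
    rcases hprime ⊤ C (fun _ _ _ => ⟨trivial, trivial⟩) hC (fun x _ y hy => hy x) with h | h
    · exact le_top.trans h
    · exact h
  let D : Submodule ℂ A :=
    { carrier := {x | ∀ b, x * b * a ∈ P}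
      add_mem' := fun {x y} hx hy b => by rw [add_mul, add_mul]; exact add_mem (hx b) (hy b)
      zero_mem' := fun b => by rw [zero_mul, zero_mul]; exact zero_mem _
      smul_mem' := fun c x hx b => by
        rw [smul_mul_assoc, smul_mul_assoc]; exact P.smul_mem c (hx b) }
  have hD : IsTwoSidedIdeal D := fun b x hx =>
    ⟨fun e => by rw [mul_assoc b, mul_assoc b]; exact (hP b _ (hx e)).1,
      fun e => by rw [mul_assoc x]; exact hx _⟩
  let E : Submodule ℂ A :=
    { carrier := {y | ∀ x ∈ D, x * y ∈ P}
      add_mem' := fun {y z} hy hz x hx => by rw [mul_add]; exact add_mem (hy x hx) (hz x hx)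
      zero_mem' := fun x _ => by rw [mul_zero]; exact zero_mem _
      smul_mem' := fun c y hy x hx => by rw [mul_smul_comm]; exact P.smul_mem c (hy x hx) }
  have hE : IsTwoSidedIdeal E := fun b y hy =>
    ⟨fun x hx => by rw [← mul_assoc]; exact hy _ (hD b x hx).2,
      fun x hx => by rw [← mul_assoc]; exact (hP b _ (hy x hx)).2⟩
  rcases hprime D E hD hE (fun x hx y hy => hy x hx) with h | h
  · exact h ha
  · exact hCP fun b => h fun x hx => by rw [← mul_assoc]; exact hx b

theorem primeRadical_isSemiprime : IsSemiprime (primeRadical A) :=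
  IsSemiprime.sInf fun _ h => h.isSemiprime

theorem jacobsonRadical_isSemiprime : IsSemiprime (jacobsonRadical A) :=
  IsSemiprime.sInf fun _ h => (IsPrimitiveIdeal.isPrimeIdeal h).isSemiprime

/-- Elements of the Jacobson radical are left quasi-regular: formally `(1 + c) (1 - b) = 1`.
Otherwise `{x - x b}` would be contained in a left ideal that is maximal among those omitting `b`,
and the quotient by it would be an irreducible module on which `b` acts nontrivially. -/
theorem exists_left_quasiInverse {b : A} (hb : b ∈ jacobsonRadical A) :
    ∃ c, c - b - c * b = 0 := by
  by_contra! hne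
  let M₀ : Submodule ℂ A :=
    { carrier := {y | ∃ x, x - x * b = y}
      add_mem' := by
        rintro _ _ ⟨x, rfl⟩ ⟨y, rfl⟩
        exact ⟨x + y, by rw [add_mul]; abel⟩
      zero_mem' := ⟨0, by simp⟩
      smul_mem' := by
        rintro c _ ⟨x, rfl⟩
        exact ⟨c • x, by rw [smul_mul_assoc, smul_sub]⟩ }
  have hbM₀ : b ∉ M₀ := by
    rintro ⟨x, hx⟩
    exact hne x (by rw [sub_right_comm, hx, sub_self])
  let T : Set (Submodule ℂ A) := {L | (∀ a, ∀ x ∈ L, a * x ∈ L) ∧ b ∉ L}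
  have hM₀T : M₀ ∈ T := by
    refine ⟨?_, hbM₀⟩
    rintro a _ ⟨x, rfl⟩
    exact ⟨a * x, by rw [mul_sub, mul_assoc]⟩
  obtain ⟨M, hM₀M, hM⟩ := zorn_le_nonempty₀ T (by
    intro c hcT hc L₀ hL₀
    refine ⟨sSup c, ⟨?_, ?_⟩, fun L hL => le_sSup hL⟩
    · intro a x hx
      rw [Submodule.mem_sSup_of_directed ⟨L₀, hL₀⟩ hc.directedOn] at hx ⊢
      obtain ⟨L, hL, hxL⟩ := hx
      exact ⟨L, hL, (hcT hL).1 a x hxL⟩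
    · intro hx
      rw [Submodule.mem_sSup_of_directed ⟨L₀, hL₀⟩ hc.directedOn] at hx
      obtain ⟨L, hL, hxL⟩ := hx
      exact (hcT hL).2 hxL) M₀ hM₀T
  have hMl := hM.prop.1
  have hbM := hM.prop.2
  have hmod : ∀ x, x - x * b ∈ M := fun x => hM₀M ⟨x, rfl⟩
  let act : A → Module.End ℂ (A ⧸ M) := fun a =>
    M.mapQ M (LinearMap.mulLeft ℂ a) (fun x hx => hMl a x hx)
  have act_mk : ∀ a x, act a (Submodule.Quotient.mk (p := M) x) =
      Submodule.Quotient.mk (p := M) (a * x) :=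
    fun a x => rfl
  have act_ext : ∀ {f g : Module.End ℂ (A ⧸ M)},
      (∀ x, f (Submodule.Quotient.mk x) = g (Submodule.Quotient.mk x)) → f = g := by
    intro f g hfg
    refine LinearMap.ext fun v => ?_
    obtain ⟨x, rfl⟩ := Submodule.Quotient.mk_surjective M v
    exact hfg x
  let π : A →ₙₐ[ℂ] Module.End ℂ (A ⧸ M) :=
    { toFun := act
      map_smul' := fun c a => act_ext fun x => by
        change Submodule.Quotient.mk (p := M) (c • a * x) =
          c • Submodule.Quotient.mk (p := M) (a * x)
        rw [smul_mul_assoc, Submodule.Quotient.mk_smul]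
      map_zero' := act_ext fun x => by
        change Submodule.Quotient.mk (0 * x) = 0
        rw [zero_mul, Submodule.Quotient.mk_zero]
      map_add' := fun a a' => act_ext fun x => by
        change Submodule.Quotient.mk (p := M) ((a + a') * x) =
          Submodule.Quotient.mk (p := M) (a * x) + Submodule.Quotient.mk (p := M) (a' * x)
        rw [add_mul, Submodule.Quotient.mk_add]
      map_mul' := fun a a' => act_ext fun x => by
        change Submodule.Quotient.mk (a * a' * x) = Submodule.Quotient.mk (a * (a' * x))
        rw [mul_assoc] }
  have hπ : IsIrreducibleRep π := by
    refine ⟨⟨b, fun h => hbM ?_⟩, fun W hW => ?_⟩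
    · have h1 : (Submodule.Quotient.mk (b * b) : A ⧸ M) = 0 :=
        LinearMap.congr_fun h (Submodule.Quotient.mk b)
      rw [Submodule.Quotient.mk_eq_zero] at h1
      simpa using add_mem (hmod b) h1
    · let L := W.comap M.mkQ
      have hLl : ∀ a, ∀ x ∈ L, a * x ∈ L := fun a x hx => hW a _ hx
      have hML : M ≤ L := fun x hx => by
        change Submodule.Quotient.mk x ∈ W
        rw [(Submodule.Quotient.mk_eq_zero M).2 hx]
        exact zero_mem _
      by_cases hbL : b ∈ L
      · right
        refine Submodule.eq_top_iff'.2 fun v => ?_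
        obtain ⟨x, rfl⟩ := Submodule.Quotient.mk_surjective M v
        have : x ∈ L := by simpa using add_mem (hML (hmod x)) (hLl x b hbL)
        exact this
      · left
        refine (Submodule.eq_bot_iff _).2 fun v hv => ?_
        obtain ⟨x, rfl⟩ := Submodule.Quotient.mk_surjective M v
        exact (Submodule.Quotient.mk_eq_zero M).2 (hM.le_of_ge ⟨hLl, hbL⟩ hML hv)
  have hker : b ∈ LinearMap.ker (π : A →ₗ[ℂ] Module.End ℂ (A ⧸ M)) :=
    Submodule.mem_sInf.1 hb _ ⟨A ⧸ M, inferInstance, inferInstance, π, hπ,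
      fun a => LinearMap.mem_ker⟩
  have h1 : (Submodule.Quotient.mk (b * b) : A ⧸ M) = 0 :=
    LinearMap.congr_fun (LinearMap.mem_ker.1 hker) (Submodule.Quotient.mk b)
  rw [Submodule.Quotient.mk_eq_zero] at h1
  exact hbM (by simpa using add_mem (hmod b) h1)

/-- Elements of the Jacobson radical are quasi-regular: formally `1 + c` is a two-sided inverse of
`1 - b`. -/
theorem exists_quasiInverse {b : A} (hb : b ∈ jacobsonRadical A) :
    ∃ c, c - b - c * b = 0 ∧ c - b - b * c = 0 := by
  obtain ⟨c, hc⟩ := exists_left_quasiInverse hb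
  have hcR : -c ∈ jacobsonRadical A := by
    have : c = b + c * b := by rw [← sub_eq_zero, ← hc]; abel
    rw [this]
    exact neg_mem (add_mem hb (jacobsonRadical_isTwoSidedIdeal c b hb).1)
  obtain ⟨e, he⟩ := exists_left_quasiInverse hcR
  refine ⟨c, hc, ?_⟩
  -- `1 + e` is a left inverse of `1 + c`, which is a left inverse of `1 - b`; so `e = -b`
  have h1 : c - b = c * b := by rw [← sub_eq_zero, hc]
  have h2 : e + c + e * c = 0 := by rw [← he]; simp [mul_neg]
  have h3 : e = -b := by
    have h4 : (e + c + e * c) * b = 0 := by rw [h2, zero_mul]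
    have h5 : e * b + c * b + e * (c * b) = 0 := by
      rw [← h4, add_mul, add_mul, mul_assoc]
    rw [← h1, mul_sub] at h5
    have h6 : e * c = -e - c := by
      rw [← sub_eq_zero, ← h2]; abel
    rw [h6] at h5
    have h7 : -b - e = 0 := by rw [← h5]; abel
    exact (sub_eq_zero.1 h7).symm
  rw [h3] at h2
  rw [← h2, neg_mul]
  abel

end Algebra

section Normed

variable {A : Type*} [NonUnitalNormedRing A] [CompleteSpace A]

/-- The Neumann series, written without a unit: `(1 + c) (1 - e) = 1`. -/
theorem exists_left_quasiInverse_of_norm_lt_one {e : A} (he : ‖e‖ < 1) :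
    ∃ c, c - e - c * e = 0 := by
  let p : ℕ → A := fun k => Nat.rec e (fun _ x => x * e) k
  have hp : ∀ k, p (k + 1) = p k * e := fun k => rfl
  have hpn : ∀ k, ‖p k‖ ≤ ‖e‖ * ‖e‖ ^ k := by
    intro k
    induction k with
    | zero => simp [p]
    | succ k ih =>
      rw [hp, pow_succ, ← mul_assoc]
      exact (norm_mul_le _ _).trans (mul_le_mul_of_nonneg_right ih (norm_nonneg _))
  have hs : Summable p := Summable.of_norm_bounded
    ((summable_geometric_of_lt_one (norm_nonneg _) he).mul_left _) hpn
  refine ⟨∑' k, p k, ?_⟩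
  rw [← hs.tsum_mul_right, sub_sub, sub_eq_zero]
  simp_rw [← hp]
  exact hs.tsum_eq_zero_add

/-- If `b` is a limit of elements of the radical and `π b v ≠ 0` for an irreducible `π`, some
`a b` fixes `v`; but `a b` is a small perturbation of the radical, so `1 - a b` acts injectively. -/
theorem jacobsonRadical_isClosed [NormedSpace ℂ A] [IsScalarTower ℂ A A] [SMulCommClass ℂ A A] :
    IsClosed (jacobsonRadical A : Set A) := by
  refine isClosed_of_closure_subset fun b hb => Submodule.mem_sInf.2 ?_
  rintro P hP
  obtain ⟨V, _, _, π, hπ, h⟩ := id hP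
  rw [h]
  refine LinearMap.ext fun v => ?_
  by_contra hv
  obtain ⟨a, ha⟩ := hπ.exists_apply_eq hv v
  have hab : a * b ∈ closure (jacobsonRadical A : Set A) :=
    map_mem_closure (continuous_const_mul a) hb fun x hx =>
      (jacobsonRadical_isTwoSidedIdeal a x hx).1
  obtain ⟨r, hr, hdist⟩ := Metric.mem_closure_iff.1 hab 1 one_pos
  rw [dist_eq_norm] at hdist
  obtain ⟨c, hc⟩ := exists_left_quasiInverse_of_norm_lt_one hdist
  have hr0 : π r = 0 := (h r).1 (Submodule.mem_sInf.1 hr P hP)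
  have hev : π (a * b - r) v = v := by
    rw [map_sub, hr0, sub_zero, map_mul]
    exact ha
  have hcv := LinearMap.congr_fun (congrArg π hc) v
  rw [map_sub, map_sub, map_mul, map_zero, LinearMap.sub_apply, LinearMap.sub_apply,
    Module.End.mul_apply, hev, sub_right_comm, sub_self, zero_sub, LinearMap.zero_apply,
    neg_eq_zero] at hcv
  rw [hcv, map_zero] at hv
  exact hv rfl

end Normed

/-- Elements of the Jacobson radical have no nonzero spectral values in any unital
algebra. -/
theorem spectralRadius_eq_zero {A L : Type*} [NonUnitalRing A] [Module ℂ A] [IsScalarTower ℂ A A]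
    [SMulCommClass ℂ A A] [NormedRing L] [NormedAlgebra ℂ L] (j : A →ₙₐ[ℂ] L) {b : A}
    (hb : b ∈ jacobsonRadical A) : spectralRadius ℂ (j b) = 0 := by
  refine nonpos_iff_eq_zero.1 (iSup₂_le fun k hk => ?_)
  by_contra hk0
  have hk0 : k ≠ 0 := by
    rintro rfl
    simp at hk0
  refine (spectrum.mem_iff.1 hk) ?_
  obtain ⟨c, h1, h2⟩ := exists_quasiInverse ((jacobsonRadical A).smul_mem k⁻¹ hb)
  replace h1 := congrArg j h1
  replace h2 := congrArg j h2
  rw [map_sub, map_sub, map_mul, map_smul, map_zero] at h1 h2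
  have hu : IsUnit (1 - k⁻¹ • j b) := by
    refine ⟨⟨1 - k⁻¹ • j b, 1 + j c, ?_, ?_⟩, rfl⟩
    · refine Eq.trans ?_ (add_eq_left.2 h2)
      simp only [mul_add, sub_mul, one_mul, mul_one]
      abel
    · refine Eq.trans ?_ (add_eq_left.2 h1)
      simp only [add_mul, mul_sub, one_mul, mul_one]
      abel
  have h3 : algebraMap ℂ L k - j b = algebraMap ℂ L k * (1 - k⁻¹ • j b) := by
    rw [mul_sub, mul_one, Algebra.algebraMap_eq_smul_one, smul_mul_smul_comm, mul_inv_cancel₀ hk0,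
      one_smul, one_mul]
  rw [h3]
  exact ((IsUnit.mk0 k hk0).map (algebraMap ℂ L)).mul hu

/-- The power `b ^ (2 ^ (K + 1) - 1)`, built from the pattern `x ↦ x b x`. -/
def dyadicPow {A : Type*} [Mul A] (b : A) : ℕ → A
  | 0 => b
  | K + 1 => dyadicPow b K * (b * dyadicPow b K)

/-- Elements of the Jacobson radical of a Banach algebra are quasi-nilpotent. The spectral radius
formula is applied in the unitization. -/
theorem exists_norm_dyadicPow_lt {A : Type*} [NonUnitalNormedRing A] [NormedSpace ℂ A]
    [IsScalarTower ℂ A A] [SMulCommClass ℂ A A] [CompleteSpace A] {b : A}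
    (hb : b ∈ jacobsonRadical A) {ε : ℝ} (hε : 0 < ε) (hε1 : ε ≤ 1) :
    ∃ K, ‖dyadicPow b K‖ < ε ^ 2 ^ K := by
  let j : A →ₙₐ[ℂ] WithLp 1 (Unitization ℂ A) :=
    (WithLp.unitizationAlgEquiv (𝕜 := ℂ) (A := A) ℂ).symm.toAlgHom.toNonUnitalAlgHom.comp
      (Unitization.inrNonUnitalAlgHom ℂ A)
  have hj : ∀ x, ‖j x‖ = ‖x‖ := fun x => WithLp.unitization_norm_inr x
  have hpow : ∀ K, j (dyadicPow b K) = j b ^ (2 ^ (K + 1) - 1) := by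
    intro K
    induction K with
    | zero => simp [dyadicPow]
    | succ K ih =>
      have h1 : 1 ≤ 2 ^ (K + 1) := Nat.one_le_two_pow
      rw [dyadicPow, map_mul, map_mul, ih, ← pow_succ', ← pow_add, pow_succ 2 (K + 1)]
      congr 1
      omega
  have hlim := spectrum.pow_nnnorm_pow_one_div_tendsto_nhds_spectralRadius (j b)
  rw [spectralRadius_eq_zero j hb] at hlim
  have hev := hlim.eventually (gt_mem_nhds (ENNReal.ofReal_pos.2 hε))
  obtain ⟨N, hN⟩ := eventually_atTop.1 hev
  have hK : N < 2 ^ N := Nat.lt_two_pow_self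
  have h1 : 2 ^ N ≤ 2 ^ (N + 1) - 1 := by
    have : 1 ≤ 2 ^ N := Nat.one_le_two_pow
    rw [pow_succ]
    omega
  refine ⟨N, ?_⟩
  set m := 2 ^ (N + 1) - 1 with hm
  have hm0 : 0 < m := (Nat.one_le_two_pow).trans h1
  have h2 := hN m (hK.le.trans h1)
  rw [← ENNReal.coe_rpow_of_nonneg _ (by positivity), ENNReal.ofReal,
    ENNReal.coe_lt_coe, one_div, NNReal.rpow_inv_lt_iff (by exact_mod_cast hm0),
    NNReal.rpow_natCast] at h2
  have h3 : ‖j b ^ m‖ < ε ^ m := by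
    have := NNReal.coe_lt_coe.2 h2
    rwa [NNReal.coe_pow, Real.coe_toNNReal _ hε.le] at this
  rw [← hj, hpow]
  exact h3.trans_le (pow_le_pow_of_le_one hε.le hε1 h1)

end AlgRad

/-! ### Functions vanishing at infinity -/

namespace ZeroAtInftyContinuousMap

variable {X : Type*} [TopologicalSpace X]

theorem norm_apply_le_norm (f : C₀(X, ℂ)) (x : X) : ‖f x‖ ≤ ‖f‖ := by
  rw [← norm_toBCF_eq_norm]
  exact f.toBCF.norm_coe_le_norm x

theorem norm_le_of_forall {f : C₀(X, ℂ)} {C : ℝ} (hC : 0 ≤ C) (h : ∀ x, ‖f x‖ ≤ C) :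
    ‖f‖ ≤ C := by
  rw [← norm_toBCF_eq_norm]
  exact (BoundedContinuousFunction.norm_le hC).2 h

variable (X) in
/-- Evaluation at a point, as a continuous linear functional. -/
noncomputable def evalCLM (x : X) : C₀(X, ℂ) →L[ℂ] ℂ :=
  LinearMap.mkContinuous
    { toFun := fun f => f x
      map_add' := fun _ _ => rfl
      map_smul' := fun _ _ => rfl } 1 fun f => by
    rw [one_mul]
    exact norm_apply_le_norm f x

@[simp] theorem evalCLM_apply (x : X) (f : C₀(X, ℂ)) : evalCLM X x f = f x := rfl

theorem exists_isCompact_norm_lt (f : C₀(X, ℂ)) {ε : ℝ} (hε : 0 < ε) :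
    ∃ C : Set X, IsCompact C ∧ ∀ x ∉ C, ‖f x‖ < ε := by
  have h := (zero_at_infty f).eventually (Metric.ball_mem_nhds (0 : ℂ) hε)
  obtain ⟨C, hC, hsub⟩ := mem_cocompact.1 h
  exact ⟨C, hC, fun x hx => by simpa using hsub hx⟩

theorem exists_bump [T2Space X] [LocallyCompactSpace X] {K V : Set X} (hK : IsCompact K) (hV : IsOpen V) (hKV : K ⊆ V) :
    ∃ g : C₀(X, ℂ), (∀ x, ∃ r : ℝ, 0 ≤ r ∧ r ≤ 1 ∧ g x = r) ∧ (∀ x ∈ K, g x = 1) ∧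
      ∀ x ∉ V, g x = 0 := by
  obtain ⟨g, h1, h0, hc, h01⟩ := exists_continuous_one_zero_of_isCompact hK hV.isClosed_compl
    (Set.disjoint_compl_right_iff_subset.2 hKV)
  have hc' : HasCompactSupport fun x => (g x : ℂ) := hc.comp_left (g := ((↑) : ℝ → ℂ)) rfl
  refine ⟨⟨⟨fun x => (g x : ℂ), by fun_prop⟩, ?_⟩, fun x => ⟨g x, (h01 x).1, (h01 x).2, rfl⟩,
    fun x hx => ?_, fun x hx => ?_⟩
  · exact hc'.is_zero_at_infty
  · change (g x : ℂ) = 1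
    rw [h1 hx]
    simp
  · change (g x : ℂ) = 0
    rw [h0 hx]
    simp

/-- Quotients `f / (η + s)` with `η > 0` and `s ≥ 0` vanish at infinity. -/
theorem exists_div (f : C₀(X, ℂ)) {s : X → ℝ} (hs : Continuous s) (hs0 : ∀ x, 0 ≤ s x) {η : ℝ}
    (hη : 0 < η) : ∃ u : C₀(X, ℂ), ∀ x, u x = f x / ((η + s x : ℝ) : ℂ) := by
  have hpos : ∀ x, 0 < η + s x := fun x => add_pos_of_pos_of_nonneg hη (hs0 x)
  refine ⟨⟨⟨fun x => f x / ((η + s x : ℝ) : ℂ), ?_⟩, ?_⟩, fun x => rfl⟩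
  · refine (map_continuous f).div (by fun_prop) fun x => ?_
    exact_mod_cast (hpos x).ne'
  · have h1 : Tendsto (fun x => ‖f x‖ / η) (cocompact X) (𝓝 0) := by
      simpa using (zero_at_infty f).norm.div_const η
    refine squeeze_zero_norm (fun x => ?_) h1
    change ‖f x / ((η + s x : ℝ) : ℂ)‖ ≤ _
    rw [norm_div, Complex.norm_real, Real.norm_of_nonneg (hpos x).le]
    exact div_le_div_of_nonneg_left (norm_nonneg _) hη (le_add_of_nonneg_right (hs0 x))

/-- A closed ideal of `C₀(X)` contains every function that vanishes on its hull. -/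
theorem mem_of_vanish_on_hull (K : Submodule ℂ C₀(X, ℂ)) (hK : IsClosed (K : Set C₀(X, ℂ)))
    (hmul : ∀ f ∈ K, ∀ g, f * g ∈ K) {f : C₀(X, ℂ)}
    (hf : ∀ x, (∀ g ∈ K, g x = 0) → f x = 0) : f ∈ K := by
  have hcl : closure (K : Set C₀(X, ℂ)) = K := hK.closure_eq
  rw [← SetLike.mem_coe, ← hcl, Metric.mem_closure_iff]
  intro ε hε
  obtain ⟨C₀, hC₀, hC₀f⟩ := f.exists_isCompact_norm_lt (half_pos hε)
  have hC : IsCompact (C₀ ∩ {x | ε / 2 ≤ ‖f x‖}) :=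
    hC₀.inter_right (isClosed_le continuous_const (map_continuous f).norm)
  set C := C₀ ∩ {x | ε / 2 ≤ ‖f x‖} with hCdef
  have hfC : ∀ x ∉ C, ‖f x‖ < ε / 2 := by
    intro x hx
    by_contra! hle
    exact hx ⟨by_contra fun h => (hC₀f x h).not_ge hle, hle⟩
  have hg : ∀ x ∈ C, ∃ g ∈ K, g x ≠ 0 := by
    intro x hx
    by_contra! h
    have := hx.2
    rw [Set.mem_ofPred_eq, hf x h, norm_zero] at this
    linarith
  choose! g hgK hgx using hg
  obtain ⟨t, htC, ht⟩ := hC.elim_nhds_subcover (fun x => {y | g x y ≠ 0}) fun x hx =>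
    (isOpen_ne_fun (map_continuous (g x)) continuous_const).mem_nhds (hgx x hx)
  let s : X → ℝ := fun y => ∑ i ∈ t, ‖g i y‖ ^ 2
  have hsc : Continuous s := continuous_finsetSum _ fun i _ => (map_continuous (g i)).norm.pow 2
  have hs0 : ∀ y, 0 ≤ s y := fun y => Finset.sum_nonneg fun i _ => sq_nonneg _
  have hsC : ∀ y ∈ C, 0 < s y := by
    intro y hy
    obtain ⟨i, hi, hiy⟩ := Set.mem_iUnion₂.1 (ht hy)
    exact Finset.sum_pos' (fun i _ => sq_nonneg _)
      ⟨i, hi, pow_pos (norm_pos_iff.2 hiy) 2⟩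
  obtain ⟨c, hc, hcs⟩ : ∃ c : ℝ, 0 < c ∧ ∀ y ∈ C, c ≤ s y := by
    rcases C.eq_empty_or_nonempty with h | h
    · exact ⟨1, one_pos, by simp [h]⟩
    · obtain ⟨y, hy, hmin⟩ := hC.exists_isMinOn h hsc.continuousOn
      exact ⟨s y, hsC y hy, fun z hz => hmin hz⟩
  let η : ℝ := c * ε / (2 * (‖f‖ + 1))
  have hf1 : 0 < ‖f‖ + 1 := by positivity
  have hη : 0 < η := by positivity
  obtain ⟨u, hu⟩ := f.exists_div hsc hs0 hη
  let q : C₀(X, ℂ) := ∑ i ∈ t, g i * (star (g i) * u)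
  have hq : ∀ y, q y = s y * u y := by
    intro y
    have h1 : q y = ∑ i ∈ t, (g i * (star (g i) * u)) y := map_sum (evalCLM X y) _ t
    rw [h1]
    simp only [s]
    push_cast
    rw [Finset.sum_mul]
    refine Finset.sum_congr rfl fun i _ => ?_
    rw [mul_apply, mul_apply, star_apply, ← mul_assoc]
    congr 1
    exact Complex.mul_conj' (g i y)
  refine ⟨q, Submodule.sum_mem _ fun i hi => hmul _ (hgK i (htC i hi)) _, ?_⟩
  rw [dist_eq_norm]
  refine (norm_le_of_forall (half_pos hε).le fun y => ?_).trans_lt (half_lt_self hε)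
  have hpos : 0 < η + s y := add_pos_of_pos_of_nonneg hη (hs0 y)
  have hpos' : ((η + s y : ℝ) : ℂ) ≠ 0 := by exact_mod_cast hpos.ne'
  have h1 : (f - q) y = f y * ((η / (η + s y) : ℝ) : ℂ) := by
    rw [sub_apply, hq, hu]
    push_cast at hpos' ⊢
    field_simp
    ring
  have hr0 : 0 ≤ η / (η + s y) := div_nonneg hη.le hpos.le
  rw [h1, norm_mul, Complex.norm_real, Real.norm_of_nonneg hr0]
  by_cases hy : y ∈ C
  · have h2 : η / (η + s y) ≤ ε / (2 * (‖f‖ + 1)) := by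
      calc η / (η + s y) ≤ η / c := div_le_div_of_nonneg_left hη.le hc (by linarith [hcs y hy])
        _ = ε / (2 * (‖f‖ + 1)) := by simp only [η]; field_simp
    calc ‖f y‖ * (η / (η + s y)) ≤ (‖f‖ + 1) * (ε / (2 * (‖f‖ + 1))) :=
          mul_le_mul ((norm_apply_le_norm f y).trans (by linarith)) h2 hr0 hf1.le
      _ = ε / 2 := by field_simp
  · have h2 : η / (η + s y) ≤ 1 := (div_le_one hpos).2 (by linarith [hs0 y])
    calc ‖f y‖ * (η / (η + s y)) ≤ ‖f y‖ * 1 := mul_le_mul_of_nonneg_left h2 (norm_nonneg _)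
      _ ≤ ε / 2 := by rw [mul_one]; exact (hfC y hy).le

end ZeroAtInftyContinuousMap

/-! ### Returning orbits and recurrent points -/

namespace DynSystem

variable {d : ℕ} {X : Type*} [TopologicalSpace X]

/-- Along sequences `p` whose `J`-entries increase, infinitely many members share one support
`J' ⊇ J`, and sums of such members are large on all of `J'`. -/
theorem exists_return_times (Φ : DynSystem d X) {J : Set (Fin d)} {x : X}
    (hx : x ∈ Φ.recurrentPts J) :
    ∃ J' : Set (Fin d), J ⊆ J' ∧ ∀ V ∈ 𝓝 x, ∀ M : ℕ, ∃ P : Fin d → ℕ,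
      (∀ j ∈ J', M ≤ P j) ∧ (∀ j ∉ J', P j = 0) ∧ Φ.φ P x ∈ V := by
  obtain ⟨p, hp, hlim⟩ := hx
  obtain ⟨J', hJ'⟩ : ∃ J' : Set (Fin d), ∃ᶠ k in atTop, Function.support (p k) = J' := by
    by_contra! h
    have h' : ∀ᶠ k in atTop, ∀ J' : Set (Fin d), Function.support (p k) ≠ J' :=
      eventually_all.2 fun J' => h J'
    obtain ⟨k, hk⟩ := h'.exists
    exact hk _ rfl
  refine ⟨J', fun j hj => ?_, ?_⟩
  · obtain ⟨k, hk, hk1⟩ := (hJ'.and_eventually (eventually_ge_atTop 1)).exists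
    rw [← hk, Function.mem_support]
    exact (hk1.trans ((hp j hj).le_apply)).trans_lt' one_pos |>.ne'
  · have key : ∀ V ∈ 𝓝 x, ∃ P : Fin d → ℕ, (∀ j ∈ J', 1 ≤ P j) ∧ (∀ j ∉ J', P j = 0) ∧
        Φ.φ P x ∈ V := by
      intro V hV
      obtain ⟨k, hk, hkV⟩ := (hJ'.and_eventually (hlim hV)).exists
      refine ⟨p k, fun j hj => ?_, fun j hj => ?_, hkV⟩
      · rw [← hk] at hj
        exact Nat.one_le_iff_ne_zero.2 hj
      · rw [← hk] at hj
        exact Function.notMem_support.1 hj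
    intro V hV M
    obtain ⟨U, hUV, hU, hxU⟩ := mem_nhds_iff.1 hV
    suffices h : ∃ P : Fin d → ℕ, (∀ j ∈ J', M ≤ P j) ∧ (∀ j ∉ J', P j = 0) ∧ Φ.φ P x ∈ U by
      obtain ⟨P, h1, h2, h3⟩ := h
      exact ⟨P, h1, h2, hUV h3⟩
    induction M with
    | zero =>
      obtain ⟨P, -, h2, h3⟩ := key U (hU.mem_nhds hxU)
      exact ⟨P, fun _ _ => Nat.zero_le _, h2, h3⟩
    | succ M ih =>
      obtain ⟨P, h1, h2, h3⟩ := ih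
      obtain ⟨Q, h4, h5, h6⟩ := key (Φ.φ P ⁻¹' U)
        ((hU.preimage (Φ.proper P).continuous).mem_nhds h3)
      refine ⟨P + Q, fun j hj => add_le_add (h1 j hj) (h4 j hj), fun j hj => ?_, ?_⟩
      · rw [Pi.add_apply, h2 j hj, h5 j hj]
      · rw [Φ.φ_add]
        exact h6

/-- If every nonempty relatively open part of `Y` contains points that return to it arbitrarily
late in the directions of `J`, then recurrent points are dense near `Y`: a recurrent point is the
intersection of nested compact balls, each carried into its predecessor. It need not lie in
`Y`. -/
theorem subset_closure_recurrentPts [LocallyCompactSpace X] [TopologicalSpace.MetrizableSpace X]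
    (Φ : DynSystem d X) {J : Set (Fin d)} {Y : Set X}
    (hY : ∀ V : Set X, IsOpen V → (V ∩ Y).Nonempty → ∀ N : ℕ,
      ∃ m : Fin d → ℕ, (∀ j ∈ J, N ≤ m j) ∧ ∃ x ∈ V ∩ Y, Φ.φ m x ∈ V) :
    Y ⊆ closure (Φ.recurrentPts J) := by
  let _ : MetricSpace X := TopologicalSpace.metrizableSpaceMetric X
  intro y₀ hy₀
  refine mem_closure_iff.2 fun V hV hyV => ?_
  obtain ⟨ε₀, hε₀, hc₀, hV₀⟩ : ∃ ε > 0, IsCompact (Metric.closedBall y₀ ε) ∧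
      Metric.closedBall y₀ ε ⊆ V := by
    obtain ⟨C, hC, hCV, hCc⟩ := local_compact_nhds (hV.mem_nhds hyV)
    obtain ⟨ε, hε, hεC⟩ := Metric.nhds_basis_closedBall.mem_iff.1 hC
    exact ⟨ε, hε, hCc.of_isClosed_subset Metric.isClosed_closedBall hεC, hεC.trans hCV⟩
  have step : ∀ σ : {σ : X × ℝ × (Fin d → ℕ) // σ.1 ∈ Y ∧ 0 < σ.2.1},
      ∃ τ : {σ : X × ℝ × (Fin d → ℕ) // σ.1 ∈ Y ∧ 0 < σ.2.1},
        τ.1.2.1 ≤ σ.1.2.1 / 2 ∧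
        Metric.closedBall τ.1.1 τ.1.2.1 ⊆ Metric.ball σ.1.1 σ.1.2.1 ∧
        Set.MapsTo (Φ.φ τ.1.2.2) (Metric.closedBall τ.1.1 τ.1.2.1)
          (Metric.ball σ.1.1 σ.1.2.1) ∧
        ∀ j ∈ J, σ.1.2.2 j < τ.1.2.2 j := by
    rintro ⟨⟨y, ε, m⟩, hy, hε⟩
    obtain ⟨m', hm', x, ⟨hxb, hxY⟩, hx⟩ := hY (Metric.ball y ε) Metric.isOpen_ball
      ⟨y, Metric.mem_ball_self hε, hy⟩ (∑ j, m j + 1)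
    have ho : IsOpen (Metric.ball y ε ∩ Φ.φ m' ⁻¹' Metric.ball y ε) :=
      Metric.isOpen_ball.inter (Metric.isOpen_ball.preimage (Φ.proper m').continuous)
    obtain ⟨δ, hδ, hδs⟩ := Metric.nhds_basis_closedBall.mem_iff.1 (ho.mem_nhds ⟨hxb, hx⟩)
    refine ⟨⟨⟨x, min δ (ε / 2), m'⟩, hxY, lt_min hδ (half_pos hε)⟩, min_le_right _ _, ?_, ?_, ?_⟩
    · exact fun z hz => (hδs (Metric.closedBall_subset_closedBall (min_le_left _ _) hz)).1
    · exact fun z hz => (hδs (Metric.closedBall_subset_closedBall (min_le_left _ _) hz)).2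
    · exact fun j hj => (Finset.single_le_sum (f := m) (fun _ _ => Nat.zero_le _)
        (Finset.mem_univ j)).trans_lt (hm' j hj)
  choose next h1 h2 h3 h4 using step
  let σ : ℕ → {σ : X × ℝ × (Fin d → ℕ) // σ.1 ∈ Y ∧ 0 < σ.2.1} := fun k =>
    Nat.rec ⟨⟨y₀, ε₀, 0⟩, hy₀, hε₀⟩ (fun _ τ => next τ) k
  have hσ : ∀ k, σ (k + 1) = next (σ k) := fun k => rfl
  let B : ℕ → Set X := fun k => Metric.closedBall (σ k).1.1 (σ k).1.2.1
  have hBs : ∀ k, B (k + 1) ⊆ Metric.ball (σ k).1.1 (σ k).1.2.1 := fun k => h2 (σ k)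
  obtain ⟨x, hx⟩ := IsCompact.nonempty_iInter_of_sequence_nonempty_isCompact_isClosed B
    (fun k => (hBs k).trans Metric.ball_subset_closedBall)
    (fun k => ⟨(σ k).1.1, Metric.mem_closedBall_self (σ k).2.2.le⟩) hc₀
    (fun k => Metric.isClosed_closedBall)
  rw [Set.mem_iInter] at hx
  refine ⟨x, hV₀ (hx 0), fun k => (σ (k + 1)).1.2.2, fun j hj => ?_, ?_⟩
  · exact strictMono_nat_of_lt_succ fun k => h4 (σ (k + 1)) j hj
  · have hε : ∀ k, (σ k).1.2.1 ≤ ε₀ * (1 / 2) ^ k := by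
      intro k
      induction k with
      | zero => simp [σ]
      | succ k ih =>
        refine (h1 (σ k)).trans ?_
        rw [pow_succ]
        linarith
    have hlim : Tendsto (fun k : ℕ => 2 * (ε₀ * (1 / 2 : ℝ) ^ k)) atTop (𝓝 0) := by
      have := tendsto_pow_atTop_nhds_zero_of_lt_one (r := (1 / 2 : ℝ)) (by norm_num) (by norm_num)
      simpa using (this.const_mul ε₀).const_mul 2
    refine tendsto_iff_dist_tendsto_zero.2 (squeeze_zero (fun _ => dist_nonneg) (fun k => ?_) hlim)
    have ha : dist (Φ.φ (σ (k + 1)).1.2.2 x) (σ k).1.1 < (σ k).1.2.1 := h3 (σ k) (hx (k + 1))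
    have hb : dist x (σ k).1.1 ≤ (σ k).1.2.1 := hx k
    have := dist_triangle_right (Φ.φ (σ (k + 1)).1.2.2 x) x (σ k).1.1
    linarith [hε k]

end DynSystem

/-! ### Fourier coefficients in the crossed product -/

namespace DynSystem

universe u v

variable {d : ℕ} {X : Type u} [TopologicalSpace X] [T2Space X] [LocallyCompactSpace X]
  {H : Type v} [NormedAddCommGroup H] [InnerProductSpace ℂ H] [CompleteSpace H]

noncomputable instance (Φ : DynSystem d X) (ρ : C₀(X, ℂ) →⋆ₙₐ[ℂ] (H →L[ℂ] H)) :
    NormedSpace ℂ (Φ.crossedProduct ρ) where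
  norm_smul_le c T := norm_smul_le c (T : FockSpace d H →L[ℂ] FockSpace d H)

instance (Φ : DynSystem d X) (ρ : C₀(X, ℂ) →⋆ₙₐ[ℂ] (H →L[ℂ] H)) :
    CompleteSpace (Φ.crossedProduct ρ) :=
  (isClosed_closure (s := Set.range (Φ.ell1Rep ρ))).completeSpace_coe

/-- The endomorphism `α n`, as a continuous linear map. -/
noncomputable def αCLM (Φ : DynSystem d X) (n : Fin d → ℕ) : C₀(X, ℂ) →L[ℂ] C₀(X, ℂ) :=
  LinearMap.mkContinuous
    { toFun := Φ.α n
      map_add' := fun _ _ => rfl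
      map_smul' := fun _ _ => rfl } 1 fun f => by
    rw [one_mul]
    exact Φ.norm_α_le n f

@[simp] theorem α_zero (Φ : DynSystem d X) (f : C₀(X, ℂ)) : Φ.α 0 f = f := by
  ext x
  rw [α_apply, Φ.φ_zero, id]

variable (Φ : DynSystem d X) (ρ : C₀(X, ℂ) →⋆ₙₐ[ℂ] (H →L[ℂ] H))

theorem norm_monomial_le (n : Fin d → ℕ) (f : C₀(X, ℂ)) : ‖Φ.monomial ρ n f‖ ≤ ‖f‖ :=
  Φ.norm_monomialOp_le ρ n f

/-- The product rule `U_n f U_m g = U_{n+m} (α_m f · g)` in the crossed product. -/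
theorem monomial_mul (n m : Fin d → ℕ) (f g : C₀(X, ℂ)) :
    Φ.monomial ρ n f * Φ.monomial ρ m g = Φ.monomial ρ (n + m) (Φ.α m f * g) :=
  Subtype.ext (Φ.monomialOp_mul ρ n m f g)

/-- The monomials of a fixed degree, as a continuous linear map. -/
noncomputable def monomialCLM (n : Fin d → ℕ) : C₀(X, ℂ) →L[ℂ] Φ.crossedProduct ρ :=
  LinearMap.mkContinuous
    { toFun := Φ.monomial ρ n
      map_add' := fun f g => by
        refine Subtype.ext (ContinuousLinearMap.ext fun ξ => lp.ext (funext fun k => ?_))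
        change Φ.monomialOp ρ n (f + g) ξ k = Φ.monomialOp ρ n f ξ k + Φ.monomialOp ρ n g ξ k
        have e : Φ.α (k - n) (f + g) = Φ.α (k - n) f + Φ.α (k - n) g := rfl
        rw [monomialOp_apply, monomialOp_apply, monomialOp_apply, e, map_add]
        split_ifs <;> simp
      map_smul' := fun c f => by
        refine Subtype.ext (ContinuousLinearMap.ext fun ξ => lp.ext (funext fun k => ?_))
        change Φ.monomialOp ρ n (c • f) ξ k = c • Φ.monomialOp ρ n f ξ k
        have e : Φ.α (k - n) (c • f) = c • Φ.α (k - n) f := rfl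
        rw [monomialOp_apply, monomialOp_apply, e, map_smul]
        split_ifs <;> simp } 1 fun f => by
    rw [one_mul]
    exact Φ.norm_monomial_le ρ n f

/-- The set of all monomials. -/
def monomials : Set (Φ.crossedProduct ρ) := {a | ∃ n f, a = Φ.monomial ρ n f}

theorem dense_span_monomials :
    Dense (Submodule.span ℂ (Φ.monomials ρ) : Set (Φ.crossedProduct ρ)) := by
  intro a
  have ha := a.2
  change (a : FockSpace d H →L[ℂ] FockSpace d H) ∈ closure (Set.range (Φ.ell1Rep ρ)) at ha
  rw [closure_range_ell1Rep] at ha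
  rw [closure_subtype]
  refine closure_mono (fun T hT => ?_) ha
  change T ∈ Submodule.span ℂ _ at hT
  induction hT using Submodule.span_induction with
  | mem T hT =>
    obtain ⟨n, f, rfl⟩ := hT
    exact ⟨Φ.monomial ρ n f, Submodule.subset_span ⟨n, f, rfl⟩, rfl⟩
  | zero => exact ⟨0, zero_mem _, rfl⟩
  | add S T _ _ hS hT =>
    obtain ⟨S', hS', rfl⟩ := hS
    obtain ⟨T', hT', rfl⟩ := hT
    exact ⟨S' + T', add_mem hS' hT', rfl⟩
  | smul c T _ hT =>
    obtain ⟨T', hT', rfl⟩ := hT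
    exact ⟨c • T', Submodule.smul_mem _ c hT', rfl⟩

/-- A closed subspace containing all monomials is everything. -/
theorem mem_of_monomials (W : Submodule ℂ (Φ.crossedProduct ρ))
    (hW : IsClosed (W : Set (Φ.crossedProduct ρ))) (h : ∀ n f, Φ.monomial ρ n f ∈ W)
    (a : Φ.crossedProduct ρ) : a ∈ W := by
  have h1 : Submodule.span ℂ (Φ.monomials ρ) ≤ W := by
    refine Submodule.span_le.2 ?_
    rintro _ ⟨n, f, rfl⟩
    exact h n f
  exact closure_minimal h1 hW (Φ.dense_span_monomials ρ a)

theorem norm_compression_le {d : ℕ} {H : Type*} [NormedAddCommGroup H] [InnerProductSpace ℂ H]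
    (n : Fin d → ℕ) (T : FockSpace d H →L[ℂ] FockSpace d H) :
    ‖(lp.evalCLM ℂ (fun _ : Fin d → ℕ => H) 2 n).comp
      (T.comp (lp.singleContinuousLinearMap ℂ (fun _ : Fin d → ℕ => H) 2 0))‖ ≤ ‖T‖ := by
  refine ContinuousLinearMap.opNorm_le_bound _ T.opNorm_nonneg fun ξ => ?_
  change ‖(T (lp.single 2 0 ξ)) n‖ ≤ _
  refine (lp.norm_apply_le_norm (by norm_num) _ n).trans ?_
  refine (T.le_opNorm _).trans_eq ?_
  rw [lp.norm_single (by norm_num)]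

/-- The compression of an element of the crossed product to an operator from `H ⊗ e_0` to
`H ⊗ e_n`. -/
noncomputable def columnCLM (n : Fin d → ℕ) : Φ.crossedProduct ρ →L[ℂ] (H →L[ℂ] H) :=
  LinearMap.mkContinuous
    { toFun := fun a => (lp.evalCLM ℂ (fun _ : Fin d → ℕ => H) 2 n).comp
        ((a : FockSpace d H →L[ℂ] FockSpace d H).comp
          (lp.singleContinuousLinearMap ℂ (fun _ : Fin d → ℕ => H) 2 0))
      map_add' := fun _ _ => rfl
      map_smul' := fun c a => by
        refine ContinuousLinearMap.ext fun ξ => ?_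
        rfl } 1 fun a => by
    rw [one_mul]
    exact norm_compression_le n _

theorem columnCLM_monomial (n m : Fin d → ℕ) (f : C₀(X, ℂ)) :
    Φ.columnCLM ρ n (Φ.monomial ρ m f) = if n = m then ρ f else 0 := by
  refine ContinuousLinearMap.ext fun ξ => ?_
  change (Φ.monomialOp ρ m f (lp.single 2 0 ξ)) n = _
  rw [monomialOp_single, zero_add, α_zero, lp.single_apply]
  split_ifs with h
  · subst h; simp
  · exact Pi.single_eq_of_ne h _

theorem norm_columnCLM_le (n : Fin d → ℕ) (a : Φ.crossedProduct ρ) :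
    ‖Φ.columnCLM ρ n a‖ ≤ ‖a‖ :=
  norm_compression_le n _

variable {ρ}

/-- The first column of an element of the crossed product consists of operators `ρ f`, since the
range of the isometric representation `ρ` is closed. -/
theorem exists_coef (hρ : Function.Injective ρ) (n : Fin d → ℕ) (a : Φ.crossedProduct ρ) :
    ∃ f, ρ f = Φ.columnCLM ρ n a := by
  have hiso : Isometry ρ := NonUnitalStarAlgHom.isometry ρ hρ
  let R : Submodule ℂ (H →L[ℂ] H) := LinearMap.range (ρ : C₀(X, ℂ) →ₗ[ℂ] (H →L[ℂ] H))
  have hR : IsClosed (R : Set (H →L[ℂ] H)) := by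
    have := hiso.isClosedEmbedding.isClosed_range
    exact this
  refine Φ.mem_of_monomials ρ (R.comap (Φ.columnCLM ρ n : Φ.crossedProduct ρ →ₗ[ℂ] (H →L[ℂ] H)))
    (hR.preimage (Φ.columnCLM ρ n).continuous) (fun m f => ?_) a
  change Φ.columnCLM ρ n (Φ.monomial ρ m f) ∈ R
  rw [columnCLM_monomial]
  split_ifs
  · exact ⟨f, rfl⟩
  · exact zero_mem _

/-- The `n`-th Fourier coefficient of an element of the crossed product: the function `f_n` in the
formal expansion `∑ U_n f_n`. It depends on the faithfulness of `ρ`. -/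
noncomputable def coef (hρ : Function.Injective ρ) (n : Fin d → ℕ) : Φ.crossedProduct ρ →L[ℂ] C₀(X, ℂ) :=
  LinearMap.mkContinuous
    { toFun := fun a => (Φ.exists_coef hρ n a).choose
      map_add' := fun a b => hρ <|
        (Φ.exists_coef hρ n (a + b)).choose_spec.trans <| by
          rw [map_add, map_add, (Φ.exists_coef hρ n a).choose_spec,
            (Φ.exists_coef hρ n b).choose_spec]
      map_smul' := fun c a => hρ <|
        (Φ.exists_coef hρ n (c • a)).choose_spec.trans <| by
          rw [RingHom.id_apply, map_smul, map_smul, (Φ.exists_coef hρ n a).choose_spec] } 1 fun a => by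
    rw [one_mul]
    change ‖(Φ.exists_coef hρ n a).choose‖ ≤ ‖a‖
    rw [← NonUnitalStarAlgHom.norm_map ρ hρ, (Φ.exists_coef hρ n a).choose_spec]
    exact Φ.norm_columnCLM_le ρ n a

variable (hρ : Function.Injective ρ)

theorem coef_spec (n : Fin d → ℕ) (a : Φ.crossedProduct ρ) :
    ρ (Φ.coef hρ n a) = Φ.columnCLM ρ n a := (Φ.exists_coef hρ n a).choose_spec

theorem norm_coef_le (n : Fin d → ℕ) (a : Φ.crossedProduct ρ) : ‖Φ.coef hρ n a‖ ≤ ‖a‖ := by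
  rw [← NonUnitalStarAlgHom.norm_map ρ hρ, coef_spec]
  exact Φ.norm_columnCLM_le ρ n a

theorem coef_monomial (n m : Fin d → ℕ) (f : C₀(X, ℂ)) :
    Φ.coef hρ n (Φ.monomial ρ m f) = if n = m then f else 0 := by
  refine hρ ?_
  rw [coef_spec, columnCLM_monomial]
  split_ifs
  · rfl
  · rw [map_zero]

end DynSystem

/-! ### The gauge action -/

namespace DynSystem

universe u v

/-- The character `k ↦ z ^ k` of `ℤ₊ᵈ` given by a point `z` of the torus. -/
noncomputable def character {d : ℕ} (z : Fin d → Circle) (n : Fin d → ℕ) : ℂ :=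
  ∏ j, (z j : ℂ) ^ n j

section Character

variable {d : ℕ} (z : Fin d → Circle)

theorem character_add (m n : Fin d → ℕ) :
    character z (m + n) = character z m * character z n := by
  simp only [character, Pi.add_apply, pow_add, Finset.prod_mul_distrib]

@[simp] theorem norm_character (n : Fin d → ℕ) : ‖character z n‖ = 1 := by
  simp [character, norm_prod, Circle.norm_coe]

theorem character_mul_character_inv (n : Fin d → ℕ) :
    character z n * character z⁻¹ n = 1 := by
  rw [character, character, ← Finset.prod_mul_distrib]
  refine Finset.prod_eq_one fun j _ => ?_
  rw [← mul_pow, Pi.inv_apply, ← Circle.coe_mul, mul_inv_cancel, Circle.coe_one, one_pow]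

end Character

/-- The diagonal unitary on `H ⊗ ℓ²(ℤ₊ᵈ)` that multiplies `ξ ⊗ e_k` by `z ^ k`. -/
noncomputable def diagonalOp {d : ℕ} (H : Type v) [NormedAddCommGroup H] [InnerProductSpace ℂ H]
    (z : Fin d → Circle) : FockSpace d H →L[ℂ] FockSpace d H :=
  have h : ∀ (ξ : FockSpace d H) (s : Finset (Fin d → ℕ)),
      ∑ k ∈ s, ‖character z k • ξ k‖ ^ (2 : ℝ≥0∞).toReal ≤ ‖ξ‖ ^ (2 : ℝ≥0∞).toReal := by
    intro ξ s
    simp only [norm_smul, norm_character, one_mul]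
    exact lp.sum_rpow_le_norm_rpow (by norm_num) ξ s
  LinearMap.mkContinuous
    { toFun := fun ξ => ⟨fun k => character z k • ξ k, memℓp_gen' (h ξ)⟩
      map_add' := fun ξ η => lp.ext (funext fun k => smul_add _ (ξ k) (η k))
      map_smul' := fun c ξ => lp.ext (funext fun k => smul_comm _ c (ξ k)) } 1 fun ξ => by
    rw [one_mul]
    exact lp.norm_le_of_forall_sum_le (by norm_num) (norm_nonneg _) (h ξ)

theorem diagonalOp_apply {d : ℕ} {H : Type v} [NormedAddCommGroup H] [InnerProductSpace ℂ H]
    (z : Fin d → Circle) (ξ : FockSpace d H) (k : Fin d → ℕ) :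
    diagonalOp H z ξ k = character z k • ξ k := rfl

theorem norm_diagonalOp_le {d : ℕ} {H : Type v} [NormedAddCommGroup H] [InnerProductSpace ℂ H]
    (z : Fin d → Circle) : ‖diagonalOp H z‖ ≤ 1 := by
  refine ContinuousLinearMap.opNorm_le_bound _ zero_le_one fun ξ => ?_
  rw [one_mul]
  refine lp.norm_le_of_forall_sum_le (by norm_num) (norm_nonneg _) fun s => ?_
  simp only [diagonalOp_apply, norm_smul, norm_character, one_mul]
  exact lp.sum_rpow_le_norm_rpow (by norm_num) ξ s

theorem diagonalOp_inv_mul {d : ℕ} {H : Type v} [NormedAddCommGroup H] [InnerProductSpace ℂ H]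
    (z : Fin d → Circle) : diagonalOp H z⁻¹ * diagonalOp H z = 1 := by
  refine ContinuousLinearMap.ext fun ξ => lp.ext (funext fun k => ?_)
  change character z⁻¹ k • character z k • ξ k = ξ k
  rw [smul_smul, mul_comm, character_mul_character_inv, one_smul]

variable {d : ℕ} {X : Type u} [TopologicalSpace X] [T2Space X] [LocallyCompactSpace X]
  {H : Type v} [NormedAddCommGroup H] [InnerProductSpace ℂ H] [CompleteSpace H]
  (Φ : DynSystem d X) (ρ : C₀(X, ℂ) →⋆ₙₐ[ℂ] (H →L[ℂ] H))

theorem diagonalOp_conj_monomialOp (z : Fin d → Circle) (n : Fin d → ℕ) (f : C₀(X, ℂ)) :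
    diagonalOp H z * Φ.monomialOp ρ n f * diagonalOp H z⁻¹ =
      character z n • Φ.monomialOp ρ n f := by
  refine ContinuousLinearMap.ext fun ξ => lp.ext (funext fun k => ?_)
  change character z k • (Φ.monomialOp ρ n f (diagonalOp H z⁻¹ ξ) k) =
    character z n • (Φ.monomialOp ρ n f ξ k)
  rw [monomialOp_apply, monomialOp_apply]
  split_ifs with h
  · have e : character z k = character z n * character z (k - n) := by
      rw [← character_add, add_tsub_cancel_of_le h]
    rw [diagonalOp_apply, map_smul, smul_smul, e, mul_assoc, character_mul_character_inv, mul_one]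
  · rw [smul_zero, smul_zero]

theorem diagonalOp_conj_mem (z : Fin d → Circle) {T : FockSpace d H →L[ℂ] FockSpace d H}
    (hT : T ∈ Φ.crossedProduct ρ) :
    diagonalOp H z * T * diagonalOp H z⁻¹ ∈ Φ.crossedProduct ρ := by
  change T ∈ closure (Set.range (Φ.ell1Rep ρ)) at hT
  change _ ∈ closure (Set.range (Φ.ell1Rep ρ))
  rw [closure_range_ell1Rep] at hT ⊢
  have hc : Continuous fun T : FockSpace d H →L[ℂ] FockSpace d H =>
      diagonalOp H z * T * diagonalOp H z⁻¹ := by fun_prop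
  refine map_mem_closure (f := fun T => diagonalOp H z * T * diagonalOp H z⁻¹) hc hT fun S hS => ?_
  change S ∈ Submodule.span ℂ _ at hS
  induction hS using Submodule.span_induction with
  | mem S hS =>
    obtain ⟨n, f, rfl⟩ := hS
    change diagonalOp H z * _ * diagonalOp H z⁻¹ ∈ Φ.polys ρ
    rw [diagonalOp_conj_monomialOp]
    exact Submodule.smul_mem _ _ (Submodule.subset_span ⟨n, f, rfl⟩)
  | zero =>
    change diagonalOp H z * _ * diagonalOp H z⁻¹ ∈ Φ.polys ρ
    rw [mul_zero, zero_mul]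
    exact zero_mem _
  | add S T _ _ hS hT =>
    change diagonalOp H z * _ * diagonalOp H z⁻¹ ∈ Φ.polys ρ
    rw [mul_add, add_mul]
    exact add_mem hS hT
  | smul c S _ hS =>
    change diagonalOp H z * _ * diagonalOp H z⁻¹ ∈ Φ.polys ρ
    rw [mul_smul_comm, smul_mul_assoc]
    exact Submodule.smul_mem _ c hS

/-- The gauge automorphism of the crossed product given by a point `z` of the torus; it multiplies
monomials of degree `n` by `z ^ n`. -/
noncomputable def gauge (z : Fin d → Circle) : Φ.crossedProduct ρ →ₙₐ[ℂ] Φ.crossedProduct ρ where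
  toFun a := ⟨diagonalOp H z * a * diagonalOp H z⁻¹, Φ.diagonalOp_conj_mem ρ z a.2⟩
  map_zero' := Subtype.ext <| by
    change diagonalOp H z * 0 * diagonalOp H z⁻¹ = 0
    rw [mul_zero, zero_mul]
  map_add' a b := Subtype.ext <| by
    change diagonalOp H z * ((a : FockSpace d H →L[ℂ] FockSpace d H) + b) * diagonalOp H z⁻¹ =
      diagonalOp H z * a * diagonalOp H z⁻¹ + diagonalOp H z * b * diagonalOp H z⁻¹
    rw [mul_add, add_mul]
  map_smul' c a := Subtype.ext <| by
    change diagonalOp H z * (c • (a : FockSpace d H →L[ℂ] FockSpace d H)) * diagonalOp H z⁻¹ =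
      c • (diagonalOp H z * a * diagonalOp H z⁻¹)
    rw [mul_smul_comm, smul_mul_assoc]
  map_mul' a b := Subtype.ext <| by
    change diagonalOp H z * ((a : FockSpace d H →L[ℂ] FockSpace d H) * b) * diagonalOp H z⁻¹ =
      diagonalOp H z * a * diagonalOp H z⁻¹ * (diagonalOp H z * b * diagonalOp H z⁻¹)
    rw [mul_assoc (diagonalOp H z * a), ← mul_assoc (diagonalOp H z⁻¹),
      ← mul_assoc (diagonalOp H z⁻¹), diagonalOp_inv_mul, one_mul, mul_assoc, mul_assoc, mul_assoc]

theorem gauge_monomial (z : Fin d → Circle) (n : Fin d → ℕ) (f : C₀(X, ℂ)) :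
    Φ.gauge ρ z (Φ.monomial ρ n f) = character z n • Φ.monomial ρ n f :=
  Subtype.ext (Φ.diagonalOp_conj_monomialOp ρ z n f)

theorem norm_gauge_le (z : Fin d → Circle) (a : Φ.crossedProduct ρ) :
    ‖Φ.gauge ρ z a‖ ≤ ‖a‖ := by
  change ‖diagonalOp H z * (a : FockSpace d H →L[ℂ] FockSpace d H) * diagonalOp H z⁻¹‖ ≤
    ‖(a : FockSpace d H →L[ℂ] FockSpace d H)‖
  calc _ ≤ ‖diagonalOp H z‖ * ‖(a : FockSpace d H →L[ℂ] FockSpace d H)‖ * ‖diagonalOp H z⁻¹‖ :=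
        (norm_mul_le _ _).trans (mul_le_mul_of_nonneg_right (norm_mul_le _ _) (norm_nonneg _))
    _ ≤ 1 * ‖(a : FockSpace d H →L[ℂ] FockSpace d H)‖ * 1 := by
        gcongr <;> exact norm_diagonalOp_le _
    _ = _ := by rw [one_mul, mul_one]

/-! ### Abstract form of the crossed product -/

/-- A Banach algebra `A` that is densely spanned by monomials `U_n f` obeying the covariance rule
of the system `Φ`, on which Fourier coefficients and gauge automorphisms are defined and
contractive. This records what is needed of the analytic crossed product, and keeps the concrete
operators out of the rest of the argument. -/
structure FourierAlgebra (Φ : DynSystem d X) (A : Type*) [NonUnitalNormedRing A]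
    [NormedSpace ℂ A] where
  /-- the monomial `U_n f` -/
  mono : (Fin d → ℕ) → C₀(X, ℂ) →L[ℂ] A
  norm_mono_le : ∀ n f, ‖mono n f‖ ≤ ‖f‖
  mono_mul : ∀ n m f g, mono n f * mono m g = mono (n + m) (Φ.α m f * g)
  dense : Dense (Submodule.span ℂ {a | ∃ n f, a = mono n f} : Set A)
  /-- the Fourier coefficients -/
  coef : (Fin d → ℕ) → A →L[ℂ] C₀(X, ℂ)
  norm_coef_le : ∀ n a, ‖coef n a‖ ≤ ‖a‖
  coef_mono : ∀ n m f, coef n (mono m f) = if n = m then f else 0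
  /-- the gauge automorphisms -/
  gauge : (Fin d → Circle) → A →ₙₐ[ℂ] A
  norm_gauge_le : ∀ z a, ‖gauge z a‖ ≤ ‖a‖
  gauge_mono : ∀ z n f, gauge z (mono n f) = character z n • mono n f

/-- The analytic crossed product in abstract form. -/
noncomputable def fourierAlgebra {ρ : C₀(X, ℂ) →⋆ₙₐ[ℂ] (H →L[ℂ] H)}
    (hρ : Function.Injective ρ) : Φ.FourierAlgebra (Φ.crossedProduct ρ) where
  mono := Φ.monomialCLM ρ
  norm_mono_le := Φ.norm_monomial_le ρ
  mono_mul := Φ.monomial_mul ρ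
  dense := Φ.dense_span_monomials ρ
  coef := Φ.coef hρ
  norm_coef_le := Φ.norm_coef_le hρ
  coef_mono := Φ.coef_monomial hρ
  gauge := Φ.gauge ρ
  norm_gauge_le := Φ.norm_gauge_le ρ
  gauge_mono := Φ.gauge_monomial ρ

end DynSystem

/-! ### Fourier series in a Fourier algebra -/

/-- Contractions that converge on a set with dense span converge everywhere. -/
theorem tendsto_apply_of_dense_span {ι E G : Type*} [NormedAddCommGroup E] [NormedSpace ℂ E]
    [NormedAddCommGroup G] [NormedSpace ℂ G] {l : Filter ι} {T : ι → E →L[ℂ] G} {T₀ : E →L[ℂ] G}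
    (hT : ∀ i x, ‖T i x‖ ≤ ‖x‖) (hT₀ : ∀ x, ‖T₀ x‖ ≤ ‖x‖) {s : Set E}
    (hs : Dense (Submodule.span ℂ s : Set E))
    (h : ∀ x ∈ s, Tendsto (fun i => T i x) l (𝓝 (T₀ x))) (x : E) :
    Tendsto (fun i => T i x) l (𝓝 (T₀ x)) := by
  let W : Submodule ℂ E :=
    { carrier := {x | Tendsto (fun i => T i x) l (𝓝 (T₀ x))}
      add_mem' := fun {x y} hx hy => by
        change Tendsto _ _ _
        simp only [map_add]
        exact Tendsto.add hx hy
      zero_mem' := by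
        change Tendsto _ _ _
        simp only [map_zero]
        exact tendsto_const_nhds
      smul_mem' := fun c x hx => by
        change Tendsto _ _ _
        simp only [map_smul]
        exact Tendsto.const_smul hx c }
  have hW : Submodule.span ℂ s ≤ W := Submodule.span_le.2 h
  rw [Metric.tendsto_nhds]
  intro ε hε
  obtain ⟨y, hy, hxy⟩ := Metric.mem_closure_iff.1 (hs x) (ε / 3) (by positivity)
  rw [dist_eq_norm] at hxy
  have hyW : Tendsto (fun i => T i y) l (𝓝 (T₀ y)) := hW hy
  filter_upwards [Metric.tendsto_nhds.1 hyW (ε / 3) (by positivity)] with i hi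
  rw [dist_eq_norm] at hi ⊢
  have e : T i x - T₀ x = T i (x - y) + (T i y - T₀ y) - T₀ (x - y) := by
    rw [map_sub, map_sub]; abel
  rw [e]
  calc _ ≤ ‖T i (x - y)‖ + ‖T i y - T₀ y‖ + ‖T₀ (x - y)‖ :=
        (norm_sub_le _ _).trans (add_le_add_left (norm_add_le _ _) _)
    _ < ε / 3 + ε / 3 + ε / 3 := by
        linarith [hT i (x - y), hT₀ (x - y)]
    _ = ε := by ring

/-- Summability of `r ^ |n|` over multi-indices. -/
theorem summable_pow_sum (d : ℕ) {r : ℝ} (hr0 : 0 ≤ r) (hr1 : r < 1) :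
    Summable fun n : Fin d → ℕ => r ^ ∑ j, n j := by
  refine summable_of_sum_le (c := ((1 - r)⁻¹) ^ d) (fun n => pow_nonneg hr0 _) fun s => ?_
  let M := s.sup (fun n => ∑ j, n j) + 1
  have hs : s ⊆ Fintype.piFinset fun _ : Fin d => Finset.range M := by
    intro n hn
    refine Fintype.mem_piFinset.2 fun j => Finset.mem_range.2 (Nat.lt_succ_of_le ?_)
    exact (Finset.single_le_sum (fun _ _ => Nat.zero_le _) (Finset.mem_univ j)).trans
      (Finset.le_sup (f := fun n : Fin d → ℕ => ∑ j, n j) hn)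
  calc ∑ n ∈ s, r ^ ∑ j, n j
      ≤ ∑ n ∈ Fintype.piFinset fun _ : Fin d => Finset.range M, r ^ ∑ j, n j :=
        Finset.sum_le_sum_of_subset_of_nonneg hs fun _ _ _ => pow_nonneg hr0 _
    _ = ∏ _j : Fin d, ∑ t ∈ Finset.range M, r ^ t := by
        rw [Finset.prod_univ_sum]
        exact Finset.sum_congr rfl fun n _ => (Finset.prod_pow_eq_pow_sum _ _ _).symm
    _ ≤ ∏ _j : Fin d, (1 - r)⁻¹ := by
        refine Finset.prod_le_prod (fun _ _ => Finset.sum_nonneg fun _ _ => pow_nonneg hr0 _)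
          fun _ _ => ?_
        rw [← tsum_geometric_of_lt_one hr0 hr1]
        exact (summable_geometric_of_lt_one hr0 hr1).sum_le_tsum _ fun _ _ => pow_nonneg hr0 _
    _ = ((1 - r)⁻¹) ^ d := by simp

namespace DynSystem.FourierAlgebra

variable {d : ℕ} {X : Type*} [TopologicalSpace X] [T2Space X] [LocallyCompactSpace X]
  {Φ : DynSystem d X} {A : Type*} [NonUnitalNormedRing A] [NormedSpace ℂ A]
  (F : Φ.FourierAlgebra A)

theorem mem_of_mono (W : Submodule ℂ A) (hW : IsClosed (W : Set A))
    (h : ∀ n f, F.mono n f ∈ W) (a : A) : a ∈ W := by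
  have h1 : Submodule.span ℂ {a | ∃ n f, a = F.mono n f} ≤ W := by
    refine Submodule.span_le.2 ?_
    rintro _ ⟨n, f, rfl⟩
    exact h n f
  exact closure_minimal h1 hW (F.dense a)

/-- The gauge automorphism, as a continuous linear map. -/
noncomputable def gaugeCLM (z : Fin d → Circle) : A →L[ℂ] A :=
  LinearMap.mkContinuous (F.gauge z : A →ₗ[ℂ] A) 1 fun a => by
    rw [one_mul]
    exact F.norm_gauge_le z a

@[simp] theorem gaugeCLM_apply (z : Fin d → Circle) (a : A) : F.gaugeCLM z a = F.gauge z a := rfl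

theorem gauge_surjective (z : Fin d → Circle) : Function.Surjective (F.gauge z) := by
  have h : (F.gaugeCLM z).comp (F.gaugeCLM z⁻¹) = ContinuousLinearMap.id ℂ A := by
    refine ContinuousLinearMap.ext_on F.dense ?_
    rintro _ ⟨n, f, rfl⟩
    change F.gauge z (F.gauge z⁻¹ (F.mono n f)) = F.mono n f
    rw [F.gauge_mono, map_smul, F.gauge_mono, smul_smul, mul_comm, character_mul_character_inv,
      one_smul]
  exact fun a => ⟨F.gauge z⁻¹ a, DFunLike.congr_fun h a⟩

/-- The Fourier term `U_n f_n` of an element. -/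
noncomputable def term (n : Fin d → ℕ) : A →L[ℂ] A := (F.mono n).comp (F.coef n)

theorem term_apply (n : Fin d → ℕ) (a : A) : F.term n a = F.mono n (F.coef n a) := rfl

theorem norm_term_le (n : Fin d → ℕ) (a : A) : ‖F.term n a‖ ≤ ‖a‖ :=
  (F.norm_mono_le _ _).trans (F.norm_coef_le _ _)

theorem term_mono (n m : Fin d → ℕ) (f : C₀(X, ℂ)) :
    F.term n (F.mono m f) = if n = m then F.mono m f else 0 := by
  rw [term_apply, F.coef_mono]
  split_ifs with h
  · rw [h]
  · rw [map_zero]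

/-- The point of the torus whose coordinates are the `N`-th roots of unity with exponents `p`. -/
noncomputable def rootPoint (N : ℕ) (p : Fin d → Fin N) : Fin d → Circle :=
  fun j => Circle.exp (2 * Real.pi / N) ^ (p j : ℕ)

/-- The discrete Fourier average over roots of unity that approximates the `n`-th term. -/
noncomputable def average (n : Fin d → ℕ) (N : ℕ) : A →L[ℂ] A :=
  ((N : ℂ) ^ d)⁻¹ • ∑ p : Fin d → Fin N,
    character (rootPoint N p)⁻¹ n • F.gaugeCLM (rootPoint N p)

theorem norm_average_le (n : Fin d → ℕ) (N : ℕ) (a : A) : ‖F.average n N a‖ ≤ ‖a‖ := by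
  rw [average, smul_apply, sum_apply, norm_smul, norm_inv, norm_pow, Complex.norm_natCast]
  have h : ‖∑ p : Fin d → Fin N, (character (rootPoint N p)⁻¹ n • F.gaugeCLM (rootPoint N p)) a‖ ≤
      (N : ℝ) ^ d * ‖a‖ := by
    refine (norm_sum_le_of_le (f := fun p => (character (rootPoint N p)⁻¹ n •
      F.gaugeCLM (rootPoint N p)) a) _ (n := fun _ => ‖a‖) fun p _ => ?_).trans_eq ?_
    · rw [smul_apply, norm_smul, norm_character, one_mul]
      exact F.norm_gauge_le _ a
    · simp
  calc _ ≤ ((N : ℝ) ^ d)⁻¹ * ((N : ℝ) ^ d * ‖a‖) :=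
        mul_le_mul_of_nonneg_left h (by positivity)
    _ ≤ 1 * ‖a‖ := by
        rw [← mul_assoc]
        exact mul_le_mul_of_nonneg_right inv_mul_le_one (norm_nonneg _)
    _ = ‖a‖ := one_mul _

theorem sum_root_pow {N m n : ℕ} (hm : m < N) (hn : n < N) :
    ∑ t : Fin N, (((Circle.exp (2 * Real.pi / N) ^ (t : ℕ))⁻¹ : Circle) : ℂ) ^ n *
      ((Circle.exp (2 * Real.pi / N) ^ (t : ℕ) : Circle) : ℂ) ^ m = if n = m then (N : ℂ) else 0 := by
  have hN : N ≠ 0 := by omega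
  set u := Circle.exp (2 * Real.pi / N) with hu
  have hprim : IsPrimitiveRoot (u : ℂ) N := by
    have h := Complex.isPrimitiveRoot_exp N hN
    rwa [show Complex.exp (2 * Real.pi * Complex.I / N) = u by
      rw [hu, Circle.coe_exp]; congr 1; push_cast; ring] at h
  have hu0 : (u : ℂ) ≠ 0 := Circle.coe_ne_zero u
  let ω : ℂ := (u : ℂ) ^ m * ((u : ℂ) ^ n)⁻¹
  have h1 : ∀ t : ℕ, (((u ^ t)⁻¹ : Circle) : ℂ) ^ n * ((u ^ t : Circle) : ℂ) ^ m = ω ^ t := by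
    intro t
    simp only [ω, Circle.coe_inv, Circle.coe_pow]
    rw [mul_pow, inv_pow, inv_pow, ← pow_mul, ← pow_mul, ← pow_mul, ← pow_mul, mul_comm t n,
      mul_comm t m, mul_comm]
  simp only [h1]
  rw [Fin.sum_univ_eq_sum_range (fun t => ω ^ t)]
  split_ifs with h
  · have hω : ω = 1 := by
      simp only [ω, h]
      exact mul_inv_cancel₀ (pow_ne_zero _ hu0)
    simp [hω]
  · have hω : ω ≠ 1 := by
      intro h2
      rw [mul_inv_eq_one₀ (pow_ne_zero _ hu0)] at h2
      exact h (hprim.pow_inj hm hn h2).symm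
    have hωN : ω ^ N = 1 := by
      simp only [ω]
      rw [mul_pow, inv_pow, ← pow_mul, ← pow_mul, mul_comm m, mul_comm n, pow_mul, pow_mul,
        hprim.pow_eq_one, one_pow, one_pow, inv_one, one_mul]
    have := mul_geom_sum ω N
    rw [hωN, sub_self] at this
    exact (mul_eq_zero.1 this).resolve_left (sub_ne_zero.2 hω)

theorem average_mono (n m : Fin d → ℕ) (f : C₀(X, ℂ)) {N : ℕ} (hm : ∀ j, m j < N)
    (hn : ∀ j, n j < N) (hN : N ≠ 0) :
    F.average n N (F.mono m f) = F.term n (F.mono m f) := by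
  have h1 : F.average n N (F.mono m f) = (((N : ℂ) ^ d)⁻¹ * ∑ p : Fin d → Fin N,
      character (rootPoint N p)⁻¹ n * character (rootPoint N p) m) • F.mono m f := by
    rw [average, smul_apply, sum_apply, mul_smul, Finset.sum_smul]
    congr 1
    refine Finset.sum_congr rfl fun p _ => ?_
    rw [smul_apply, gaugeCLM_apply, F.gauge_mono, smul_smul]
  have h2 : ∑ p : Fin d → Fin N, character (rootPoint N p)⁻¹ n * character (rootPoint N p) m =
      ∏ j, if n j = m j then (N : ℂ) else 0 := by
    calc _ = ∑ p ∈ Fintype.piFinset fun _ : Fin d => (Finset.univ : Finset (Fin N)),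
          ∏ j, (((Circle.exp (2 * Real.pi / N) ^ (p j : ℕ))⁻¹ : Circle) : ℂ) ^ n j *
            ((Circle.exp (2 * Real.pi / N) ^ (p j : ℕ) : Circle) : ℂ) ^ m j := by
          rw [Fintype.piFinset_univ]
          exact Finset.sum_congr rfl fun p _ => Finset.prod_mul_distrib.symm
      _ = ∏ j, ∑ t : Fin N, (((Circle.exp (2 * Real.pi / N) ^ (t : ℕ))⁻¹ : Circle) : ℂ) ^ n j *
            ((Circle.exp (2 * Real.pi / N) ^ (t : ℕ) : Circle) : ℂ) ^ m j :=
          (Finset.prod_univ_sum (fun _ => Finset.univ) fun j (t : Fin N) =>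
            (((Circle.exp (2 * Real.pi / N) ^ (t : ℕ))⁻¹ : Circle) : ℂ) ^ n j *
            ((Circle.exp (2 * Real.pi / N) ^ (t : ℕ) : Circle) : ℂ) ^ m j).symm
      _ = _ := Finset.prod_congr rfl fun j _ => sum_root_pow (hm j) (hn j)
  rw [h1, h2, term_mono]
  by_cases h : n = m
  · subst h
    have hN' : (N : ℂ) ≠ 0 := by exact_mod_cast hN
    simp [hN']
  · obtain ⟨j, hj⟩ := Function.ne_iff.1 h
    rw [Finset.prod_eq_zero (Finset.mem_univ j) (if_neg hj), mul_zero, zero_smul, if_neg h]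

/-- The terms of the Fourier series of an element lie in every gauge-invariant closed subspace that
contains it. -/
theorem term_mem {W : Submodule ℂ A} (hW : IsClosed (W : Set A))
    (hg : ∀ z, ∀ a ∈ W, F.gauge z a ∈ W) {a : A} (ha : a ∈ W) (n : Fin d → ℕ) :
    F.term n a ∈ W := by
  have hlim := tendsto_apply_of_dense_span (F.norm_average_le n) (F.norm_term_le n) F.dense
    (l := atTop) (by
      rintro _ ⟨m, f, rfl⟩
      refine tendsto_const_nhds.congr' ?_
      filter_upwards [eventually_gt_atTop (∑ j, m j + ∑ j, n j)] with N hN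
      refine (F.average_mono n m f (fun j => ?_) (fun j => ?_) (by omega)).symm
      · have := Finset.single_le_sum (f := m) (fun _ _ => Nat.zero_le _) (Finset.mem_univ j)
        omega
      · have := Finset.single_le_sum (f := n) (fun _ _ => Nat.zero_le _) (Finset.mem_univ j)
        omega) a
  refine hW.mem_of_tendsto hlim (Eventually.of_forall fun N => ?_)
  rw [average, smul_apply, sum_apply]
  refine W.smul_mem _ (W.sum_mem fun p _ => ?_)
  rw [smul_apply]
  exact W.smul_mem _ (hg _ a ha)

/-- The Abel mean `∑ r ^ |n| U_n f_n`. -/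
noncomputable def abelMean (r : ℝ) : A →L[ℂ] A := ∑' n : Fin d → ℕ, ((r : ℂ) ^ ∑ j, n j) • F.term n

theorem exists_finset_term {a : A} (ha : a ∈ Submodule.span ℂ {a | ∃ n f, a = F.mono n f}) :
    ∃ S : Finset (Fin d → ℕ), (∀ n ∉ S, F.term n a = 0) ∧ ∑ n ∈ S, F.term n a = a := by
  classical
  induction ha using Submodule.span_induction with
  | mem a ha =>
    obtain ⟨m, f, rfl⟩ := ha
    refine ⟨{m}, fun n hn => ?_, ?_⟩
    · rw [term_mono, if_neg (by simpa using hn)]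
    · rw [Finset.sum_singleton, term_mono, if_pos rfl]
  | zero => exact ⟨∅, fun n _ => map_zero _, by simp⟩
  | add a b _ _ ha hb =>
    obtain ⟨S, hS, hSa⟩ := ha
    obtain ⟨T, hT, hTb⟩ := hb
    refine ⟨S ∪ T, fun n hn => ?_, ?_⟩
    · rw [Finset.mem_union, not_or] at hn
      rw [map_add, hS n hn.1, hT n hn.2, add_zero]
    · simp only [map_add, Finset.sum_add_distrib]
      rw [← Finset.sum_subset Finset.subset_union_left fun n _ hn => hS n hn,
        ← Finset.sum_subset Finset.subset_union_right fun n _ hn => hT n hn, hSa, hTb]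
  | smul c a _ ha =>
    obtain ⟨S, hS, hSa⟩ := ha
    refine ⟨S, fun n hn => by rw [map_smul, hS n hn, smul_zero], ?_⟩
    simp only [map_smul, ← Finset.smul_sum, hSa]

/-- Polynomials satisfy the contraction estimate by the maximum principle: on the unit circle,
`∑ w ^ |n| U_n f_n` is the image of `∑ U_n f_n` under a gauge automorphism. -/
theorem norm_sum_pow_smul_term_le {a : A} {S : Finset (Fin d → ℕ)}
    (hS : ∑ n ∈ S, F.term n a = a) {r : ℝ} (hr0 : 0 ≤ r) (hr1 : r ≤ 1) :
    ‖∑ n ∈ S, ((r : ℂ) ^ ∑ j, n j) • F.term n a‖ ≤ ‖a‖ := by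
  let P : ℂ → A := fun w => ∑ n ∈ S, (w ^ ∑ j, n j) • F.term n a
  have hP : Differentiable ℂ P := by
    refine Differentiable.fun_sum fun n _ => ?_
    exact (differentiable_id.pow _).smul_const _
  refine Complex.norm_le_of_forall_mem_frontier_norm_le (f := P) (U := Metric.ball 0 1)
    Metric.isBounded_ball hP.diffContOnCl (fun w hw => ?_) (z := (r : ℂ)) ?_
  · rw [frontier_ball _ one_ne_zero, mem_sphere_zero_iff_norm] at hw
    obtain ⟨z, rfl⟩ : ∃ z : Circle, (z : ℂ) = w := ⟨⟨w, mem_sphere_zero_iff_norm.2 hw⟩, rfl⟩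
    have hPw : P z = F.gauge (fun _ => z) a := by
      conv_rhs => rw [← hS]
      rw [map_sum]
      refine Finset.sum_congr rfl fun n _ => ?_
      rw [term_apply, F.gauge_mono, character, Finset.prod_pow_eq_pow_sum]
    rw [hPw]
    exact F.norm_gauge_le _ a
  · rw [closure_ball _ one_ne_zero, mem_closedBall_zero_iff, Complex.norm_real,
      Real.norm_of_nonneg hr0]
    exact hr1

variable [CompleteSpace A]

theorem summable_abelMean {r : ℝ} (hr0 : 0 ≤ r) (hr1 : r < 1) :
    Summable fun n : Fin d → ℕ => ((r : ℂ) ^ ∑ j, n j) • F.term n := by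
  refine Summable.of_norm_bounded (summable_pow_sum d hr0 hr1) fun n => ?_
  rw [norm_smul, norm_pow, Complex.norm_real, Real.norm_of_nonneg hr0]
  refine mul_le_of_le_one_right (pow_nonneg hr0 _) ?_
  exact ContinuousLinearMap.opNorm_le_bound _ zero_le_one fun a => by
    rw [one_mul]; exact F.norm_term_le n a

theorem hasSum_abelMean {r : ℝ} (hr0 : 0 ≤ r) (hr1 : r < 1) (a : A) :
    HasSum (fun n : Fin d → ℕ => ((r : ℂ) ^ ∑ j, n j) • F.term n a) (F.abelMean r a) :=
  (F.summable_abelMean hr0 hr1).hasSum.mapL (ContinuousLinearMap.apply ℂ A a)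

theorem norm_abelMean_le {r : ℝ} (hr0 : 0 ≤ r) (hr1 : r < 1) (a : A) :
    ‖F.abelMean r a‖ ≤ ‖a‖ := by
  refine closure_minimal (s := (Submodule.span ℂ {a | ∃ n f, a = F.mono n f} : Set A))
    (t := {a | ‖F.abelMean r a‖ ≤ ‖a‖}) (fun b hb => ?_)
    (isClosed_le (F.abelMean r).continuous.norm continuous_norm) (F.dense a)
  obtain ⟨S, hS0, hS⟩ := F.exists_finset_term hb
  have h : F.abelMean r b = ∑ n ∈ S, ((r : ℂ) ^ ∑ j, n j) • F.term n b :=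
    (F.hasSum_abelMean hr0 hr1 b).unique
      (hasSum_sum_of_ne_finset_zero fun n hn => by rw [hS0 n hn, smul_zero])
  rw [Set.mem_ofPred_eq, h]
  exact F.norm_sum_pow_smul_term_le hS hr0 hr1.le

/-- Fourier series are Abel summable in norm; so an element lies in every closed subspace that
contains the terms of its Fourier series. -/
theorem mem_of_term_mem {W : Submodule ℂ A} (hW : IsClosed (W : Set A)) {a : A}
    (ha : ∀ n, F.term n a ∈ W) : a ∈ W := by
  let r : ℕ → ℝ := fun k => k / (k + 1)
  have hr0 : ∀ k, 0 ≤ r k := fun k => by positivity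
  have hr1 : ∀ k, r k < 1 := fun k => (div_lt_one (by positivity)).2 (lt_add_one _)
  have hr : Tendsto r atTop (𝓝 1) := tendsto_natCast_div_add_atTop 1
  have hlim := tendsto_apply_of_dense_span (T := fun k => F.abelMean (r k))
    (T₀ := ContinuousLinearMap.id ℂ A) (fun k => F.norm_abelMean_le (hr0 k) (hr1 k))
    (fun x => le_rfl) F.dense (l := atTop) (by
      rintro _ ⟨m, f, rfl⟩
      have h : ∀ k, F.abelMean (r k) (F.mono m f) = ((r k : ℂ) ^ ∑ j, m j) • F.mono m f := by
        intro k
        refine (F.hasSum_abelMean (hr0 k) (hr1 k) _).unique ?_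
        have := hasSum_ite_eq m (((r k : ℂ) ^ ∑ j, m j) • F.mono m f)
        convert this using 2 with n
        rw [term_mono]
        split_ifs with hnm
        · rw [hnm]
        · rw [smul_zero]
      simp only [h]
      have h1 : Tendsto (fun k => ((r k : ℂ) ^ ∑ j, m j)) atTop (𝓝 1) := by
        have := ((Complex.continuous_ofReal.tendsto 1).comp hr).pow (∑ j, m j)
        simpa using this
      simpa using h1.smul_const (F.mono m f)) a
  refine hW.mem_of_tendsto hlim (Eventually.of_forall fun k => ?_)
  exact hW.mem_of_tendsto (F.hasSum_abelMean (hr0 k) (hr1 k) a)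
    (Eventually.of_forall fun s => W.sum_mem fun n _ => W.smul_mem _ (ha n))

end DynSystem.FourierAlgebra

/-! ### Monomials in closed semiprime ideals -/

namespace DynSystem.FourierAlgebra

open AlgRad

variable {d : ℕ} {X : Type*} [TopologicalSpace X] [T2Space X] [LocallyCompactSpace X]
  {Φ : DynSystem d X} {A : Type*} [NonUnitalNormedRing A] [NormedSpace ℂ A]
  (F : Φ.FourierAlgebra A) {I : Submodule ℂ A}

/-- The ideal of all `f` for which the monomial `U_n f` lies in `I`. -/
noncomputable def coefIdeal (I : Submodule ℂ A) (n : Fin d → ℕ) : Submodule ℂ C₀(X, ℂ) :=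
  I.comap (F.mono n : C₀(X, ℂ) →ₗ[ℂ] A)

theorem mem_coefIdeal {n : Fin d → ℕ} {f : C₀(X, ℂ)} : f ∈ F.coefIdeal I n ↔ F.mono n f ∈ I :=
  Iff.rfl

theorem isClosed_coefIdeal (hc : IsClosed (I : Set A)) (n : Fin d → ℕ) :
    IsClosed (F.coefIdeal I n : Set C₀(X, ℂ)) :=
  hc.preimage (F.mono n).continuous

theorem mul_mem_coefIdeal (hI : IsTwoSidedIdeal I) {n : Fin d → ℕ} {f : C₀(X, ℂ)}
    (hf : f ∈ F.coefIdeal I n) (g : C₀(X, ℂ)) : f * g ∈ F.coefIdeal I n := by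
  have h := (hI (F.mono 0 g) _ (F.mem_coefIdeal.1 hf)).2
  rwa [F.mono_mul, α_zero, add_zero] at h

/-- Left multiplication by `U_m g` with `g` close to `1` raises the degree of a monomial. -/
theorem coefIdeal_le_add (hI : IsTwoSidedIdeal I) (hc : IsClosed (I : Set A)) (m n : Fin d → ℕ) :
    F.coefIdeal I n ≤ F.coefIdeal I (m + n) := by
  intro f hf
  rw [← SetLike.mem_coe, ← (F.isClosed_coefIdeal hc (m + n)).closure_eq, Metric.mem_closure_iff]
  intro ε hε
  obtain ⟨C, hC, hCf⟩ := f.exists_isCompact_norm_lt (half_pos hε)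
  obtain ⟨g, hg, hg1, -⟩ := ZeroAtInftyContinuousMap.exists_bump
    (hC.image (Φ.proper n).continuous) isOpen_univ (Set.subset_univ _)
  refine ⟨Φ.α n g * f, ?_, ?_⟩
  · have h := (hI (F.mono m g) _ (F.mem_coefIdeal.1 hf)).1
    rwa [F.mono_mul] at h
  · rw [dist_eq_norm]
    refine (ZeroAtInftyContinuousMap.norm_le_of_forall (half_pos hε).le fun x => ?_).trans_lt
      (half_lt_self hε)
    rw [ZeroAtInftyContinuousMap.sub_apply, ZeroAtInftyContinuousMap.mul_apply, α_apply]
    by_cases hx : x ∈ C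
    · rw [hg1 _ ⟨x, hx, rfl⟩, one_mul, sub_self, norm_zero]
      exact (half_pos hε).le
    · obtain ⟨r, hr0, hr1, hr⟩ := hg (Φ.φ n x)
      have e : f x - r * f x = ((1 - r : ℝ) : ℂ) * f x := by push_cast; ring
      rw [hr, e, norm_mul, Complex.norm_real, Real.norm_of_nonneg (by linarith)]
      have := hCf x hx
      nlinarith [norm_nonneg (f x)]

variable [IsScalarTower ℂ A A] [SMulCommClass ℂ A A]

/-- For closed `I`, the semiprimeness condition on a monomial need only be tested against
monomials. -/
theorem mono_mem_of_isSemiprime (hc : IsClosed (I : Set A)) (hs : IsSemiprime I)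
    {n : Fin d → ℕ} {f : C₀(X, ℂ)}
    (h : ∀ m g, Φ.α (n + m) f * Φ.α n g * f ∈ F.coefIdeal I (m + (n + n))) :
    f ∈ F.coefIdeal I n := by
  refine hs _ fun b => ?_
  let W : Submodule ℂ A :=
    { carrier := {b | F.mono n f * b * F.mono n f ∈ I}
      add_mem' := fun {x y} hx hy => by
        change _ ∈ I
        rw [mul_add, add_mul]
        exact add_mem hx hy
      zero_mem' := by
        change _ ∈ I
        rw [mul_zero, zero_mul]
        exact zero_mem _
      smul_mem' := fun c x hx => by
        change _ ∈ I
        rw [mul_smul_comm, smul_mul_assoc]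
        exact I.smul_mem c hx }
  have hW : IsClosed (W : Set A) :=
    hc.preimage ((continuous_const_mul _).mul continuous_const)
  refine F.mem_of_mono W hW (fun m g => ?_) b
  change F.mono n f * F.mono m g * F.mono n f ∈ I
  have h1 := F.mem_coefIdeal.1 (h m g)
  have e : Φ.α n (Φ.α m f * g) * f = Φ.α (n + m) f * Φ.α n g * f := by
    ext x
    simp only [ZeroAtInftyContinuousMap.mul_apply, α_apply, add_comm n m, Φ.φ_add,
      Function.comp_apply]
  rw [F.mono_mul, F.mono_mul, e, show n + m + n = m + (n + n) by abel]
  exact h1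

theorem coefIdeal_two_pow_le (hI : IsTwoSidedIdeal I) (hc : IsClosed (I : Set A))
    (hs : IsSemiprime I) (n : Fin d → ℕ) (N : ℕ) :
    F.coefIdeal I (2 ^ N • n) ≤ F.coefIdeal I n := by
  induction N with
  | zero => simp
  | succ N ih =>
    refine le_trans (fun f hf => ?_) ih
    refine F.mono_mem_of_isSemiprime hc hs fun m g => F.coefIdeal_le_add hI hc _ _ ?_
    rw [← two_nsmul, smul_smul, ← pow_succ', mul_comm]
    exact F.mul_mem_coefIdeal hI hf _

/-- Let `Y` be the hull of the ideal of all `f` with `U_n f ∈ I`. Every nonempty relatively open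
part of `Y` returns to itself arbitrarily late in the directions of the support of `n`: if no point
of `V ∩ Y` returned to `V`, then `(U_n' f) A (U_n' f) ⊆ I` for every `f` supported in `V`, where
`n'` is a large multiple of `n`. -/
theorem exists_return (hI : IsTwoSidedIdeal I) (hc : IsClosed (I : Set A))
    (hs : IsSemiprime I) (n : Fin d → ℕ) {V : Set X} (hV : IsOpen V)
    (hne : (V ∩ {x | ∀ f ∈ F.coefIdeal I n, f x = 0}).Nonempty) (N : ℕ) :
    ∃ m : Fin d → ℕ, (∀ j ∈ Function.support n, N ≤ m j) ∧
      ∃ x ∈ V ∩ {x | ∀ f ∈ F.coefIdeal I n, f x = 0}, Φ.φ m x ∈ V := by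
  obtain ⟨y, hyV, hy⟩ := hne
  by_contra! hno
  obtain ⟨f, -, hf1, hfV⟩ := ZeroAtInftyContinuousMap.exists_bump isCompact_singleton hV
    (Set.singleton_subset_iff.2 hyV)
  have hmem : f ∈ F.coefIdeal I (2 ^ N • n) := by
    refine F.mono_mem_of_isSemiprime hc hs fun m g => ?_
    refine ZeroAtInftyContinuousMap.mem_of_vanish_on_hull _ (F.isClosed_coefIdeal hc _)
      (fun f hf g => F.mul_mem_coefIdeal hI hf g) fun x hx => ?_
    by_contra hne
    rw [ZeroAtInftyContinuousMap.mul_apply, ZeroAtInftyContinuousMap.mul_apply, α_apply] at hne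
    have hxV : x ∈ V := by
      by_contra h
      exact hne (by rw [hfV x h, mul_zero])
    have hφV : Φ.φ (2 ^ N • n + m) x ∈ V := by
      by_contra h
      exact hne (by rw [hfV _ h, zero_mul, zero_mul])
    refine hno (2 ^ N • n + m) (fun j hj => ?_) x ⟨hxV, fun g hg => hx g ?_⟩ hφV
    · have h1 : 1 ≤ n j := Nat.one_le_iff_ne_zero.2 hj
      have h2 : N < 2 ^ N := Nat.lt_two_pow_self
      rw [Pi.add_apply, Pi.smul_apply, smul_eq_mul]
      nlinarith
    · have e : m + (2 ^ N • n + 2 ^ N • n) =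
          (m + 2 ^ N • n + (2 ^ N - 1) • n) + n := by
        have : 2 ^ N • n = (2 ^ N - 1) • n + n := by
          rw [← succ_nsmul, Nat.sub_add_cancel Nat.one_le_two_pow]
        nth_rw 2 [this]
        abel
      rw [e]
      exact F.coefIdeal_le_add hI hc _ _ hg
  have h0 : f y = 0 := hy f (F.coefIdeal_two_pow_le hI hc hs n N hmem)
  rw [hf1 y rfl] at h0
  exact one_ne_zero h0

/-- A closed semiprime ideal contains every monomial `U_n f` for which `f` vanishes on the points
that are recurrent in the directions of `n`. -/
theorem mono_mem_of_vanish_on_recurrentPts [TopologicalSpace.MetrizableSpace X]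
    (hI : IsTwoSidedIdeal I) (hc : IsClosed (I : Set A)) (hs : IsSemiprime I) (n : Fin d → ℕ)
    {f : C₀(X, ℂ)} (hf : ∀ x ∈ Φ.recurrentPts (Function.support n), f x = 0) :
    F.mono n f ∈ I := by
  refine F.mem_coefIdeal.1 <| ZeroAtInftyContinuousMap.mem_of_vanish_on_hull _
    (F.isClosed_coefIdeal hc n) (fun f hf g => F.mul_mem_coefIdeal hI hf g) fun x hx => ?_
  have hcl := Φ.subset_closure_recurrentPts
    (fun V hV hne N => F.exists_return hI hc hs n hV hne N) hx
  exact closure_minimal (t := {x | f x = 0}) hf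
    (isClosed_eq (map_continuous f) continuous_const) hcl

end DynSystem.FourierAlgebra

/-! ### Monomials in the Jacobson radical -/

namespace DynSystem

/-- The returning scheme behind the lower bound for powers. With `W_0 = (r_0)` and
`W_{K+1} = (W_K, r_{K+1}, W_K)`, the word `W_K` has total displacement `s_K`, and `b_K y` is the
product of the weights `2 ^ -(k+1)` of its letters `r_k` and of the values of `h` along the orbit of
`y` that follows `W_K`. The letters are chosen so that `s_K + r_{K+1}` is a return time of `x`: the
second passage through `W_K` then starts near `x` again. -/
theorem exists_dyadic_scheme {d : ℕ} {X : Type*} [TopologicalSpace X] (Φ : DynSystem d X)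
    {J : Set (Fin d)} {x : X} (hx : x ∈ Φ.recurrentPts J) {n : Fin d → ℕ}
    (hn : Function.support n ⊆ J) {h : X → ℝ} (hc : Continuous h) (h0 : ∀ y, 0 ≤ h y)
    (hx1 : 1 < h x) :
    ∃ (r s : ℕ → Fin d → ℕ) (b : ℕ → X → ℝ), (∀ K, n ≤ r K) ∧ s 0 = r 0 ∧
      (∀ K, s (K + 1) = s K + (r (K + 1) + s K)) ∧ (∀ y, b 0 y = 1 / 2 * h y) ∧
      (∀ K y, b (K + 1) y = b K (Φ.φ (r (K + 1) + s K) y) *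
        ((1 / 2) ^ (K + 2) * h (Φ.φ (s K) y) * b K y)) ∧
      (∀ K y, 0 ≤ b K y) ∧ ∀ K, (1 / 16) ^ 2 ^ K ≤ b K x := by
  obtain ⟨J', hJJ', hret⟩ := Φ.exists_return_times hx
  have hn0 : ∀ j ∉ J', n j = 0 := fun j hj =>
    Function.notMem_support.1 fun h => hj (hJJ' (hn h))
  let Q : ℕ → (Fin d → ℕ) × (Fin d → ℕ) × (X → ℝ) → Prop := fun K σ =>
    n ≤ σ.1 ∧ (∀ j ∉ J', σ.2.1 j = 0) ∧ Continuous σ.2.2 ∧ (∀ y, 0 ≤ σ.2.2 y) ∧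
      1 < h (Φ.φ σ.2.1 x) ∧ 2 ^ (K + 3) / 16 ^ 2 ^ K < σ.2.2 x
  have start : ∃ σ, Q 0 σ ∧ σ.2.1 = σ.1 ∧ ∀ y, σ.2.2 y = 1 / 2 * h y := by
    obtain ⟨P, hP, hP0, hPU⟩ := hret {y | 1 < h y}
      ((isOpen_lt continuous_const hc).mem_nhds hx1) (∑ j, n j)
    refine ⟨⟨P, P, fun y => 1 / 2 * h y⟩, ⟨fun j => ?_, hP0, by fun_prop,
      fun y => by have := h0 y; positivity, hPU, ?_⟩, rfl, fun y => rfl⟩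
    · by_cases hj : j ∈ J'
      · exact (Finset.single_le_sum (f := n) (fun _ _ => Nat.zero_le _)
          (Finset.mem_univ j)).trans (hP j hj)
      · rw [hn0 j hj]
        exact Nat.zero_le _
    · norm_num
      linarith
  have step : ∀ K (σ : {σ // Q K σ}), ∃ τ : {τ // Q (K + 1) τ},
      τ.1.2.1 = σ.1.2.1 + (τ.1.1 + σ.1.2.1) ∧
      ∀ y, τ.1.2.2 y = σ.1.2.2 (Φ.φ (τ.1.1 + σ.1.2.1) y) *
        ((1 / 2) ^ (K + 2) * h (Φ.φ σ.1.2.1 y) * σ.1.2.2 y) := by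
    rintro K ⟨⟨r, s, b⟩, -, hs, hbc, hb0, hhs, hbx⟩
    dsimp only at hs hbc hb0 hhs hbx ⊢
    have hφ : ∀ m, Continuous (Φ.φ m) := fun m => (Φ.proper m).continuous
    obtain ⟨P, hP, hP0, hPb, hPh⟩ := hret
      ({y | 2 ^ (K + 3) / 16 ^ 2 ^ K < b y} ∩ {y | 1 < h (Φ.φ s y)})
      (((isOpen_lt continuous_const hbc).inter
        (isOpen_lt continuous_const (hc.comp (hφ s)))).mem_nhds ⟨hbx, hhs⟩)
      (∑ j, s j + ∑ j, n j)
    rw [Set.mem_ofPred_eq] at hPb hPh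
    have hsn : s + n ≤ P := by
      intro j
      by_cases hj : j ∈ J'
      · refine le_trans (add_le_add ?_ ?_) (hP j hj)
        · exact Finset.single_le_sum (f := s) (fun _ _ => Nat.zero_le _) (Finset.mem_univ j)
        · exact Finset.single_le_sum (f := n) (fun _ _ => Nat.zero_le _) (Finset.mem_univ j)
      · rw [Pi.add_apply, hs j hj, hn0 j hj]
        exact Nat.zero_le _
    have hPs : P - s + s = P := tsub_add_cancel_of_le (le_self_add.trans hsn)
    refine ⟨⟨⟨P - s, s + P, fun y => b (Φ.φ P y) * ((1 / 2) ^ (K + 2) * h (Φ.φ s y) * b y)⟩,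
      ?_, ?_, ?_, ?_, ?_, ?_⟩, ?_, ?_⟩
    · exact le_tsub_of_add_le_left hsn
    · intro j hj
      change s j + P j = 0
      rw [hs j hj, hP0 j hj]
    · exact (hbc.comp (hφ P)).mul ((continuous_const.mul (hc.comp (hφ s))).mul hbc)
    · intro y
      have h1 := hb0 (Φ.φ P y)
      have h2 := hb0 y
      have h3 := h0 (Φ.φ s y)
      dsimp only
      positivity
    · change 1 < h (Φ.φ (s + P) x)
      rw [Φ.φ_add]
      exact hPh
    · dsimp only
      have hβ : (0 : ℝ) < 2 ^ (K + 3) / 16 ^ 2 ^ K := by positivity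
      have e : (2 : ℝ) ^ (K + 1 + 3) / 16 ^ 2 ^ (K + 1) =
          2 ^ (K + 3) / 16 ^ 2 ^ K * ((1 / 2) ^ (K + 2) * 1 * (2 ^ (K + 3) / 16 ^ 2 ^ K)) := by
        rw [pow_succ 2 K, pow_mul, one_div, inv_pow]
        field_simp
        ring
      rw [e]
      gcongr
    · change s + P = s + (P - s + s)
      rw [hPs]
    · intro y
      dsimp only
      rw [hPs]
  obtain ⟨σ₀, hσ₀, hrs, hb⟩ := start
  choose next h1 h2 using step
  let σ : ∀ K, {σ // Q K σ} := fun K => Nat.rec ⟨σ₀, hσ₀⟩ (fun K τ => next K τ) K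
  refine ⟨fun K => (σ K).1.1, fun K => (σ K).1.2.1, fun K => (σ K).1.2.2,
    fun K => (σ K).2.1, hrs, fun K => h1 K (σ K), hb, fun K y => h2 K (σ K) y,
    fun K => (σ K).2.2.2.2.1, fun K => ?_⟩
  refine le_trans ?_ (σ K).2.2.2.2.2.2.le
  rw [one_div, inv_pow, ← one_div]
  gcongr
  exact one_le_pow₀ one_le_two

namespace FourierAlgebra

open AlgRad
open scoped ComplexOrder

variable {d : ℕ} {X : Type*} [TopologicalSpace X] [T2Space X] [LocallyCompactSpace X]
  {Φ : DynSystem d X} {A : Type*} [NonUnitalNormedRing A] [NormedSpace ℂ A]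
  [IsScalarTower ℂ A A] [SMulCommClass ℂ A A] (F : Φ.FourierAlgebra A)

/-- Fourier coefficients of a product are twisted convolutions. -/
theorem coef_mul (n : Fin d → ℕ) (a b : A) :
    F.coef n (a * b) = ∑ k ∈ Finset.Iic n, Φ.α (n - k) (F.coef k a) * F.coef (n - k) b := by
  have hα0 : ∀ k, Φ.α k (0 : C₀(X, ℂ)) = 0 := fun k => rfl
  have hαadd : ∀ k (f g : C₀(X, ℂ)), Φ.α k (f + g) = Φ.α k f + Φ.α k g := fun _ _ _ => rfl
  have hαsmul : ∀ k (c : ℂ) (f : C₀(X, ℂ)), Φ.α k (c • f) = c • Φ.α k f := fun _ _ _ => rfl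
  -- the identity is linear and continuous in each factor, so monomials suffice
  let L : A → Submodule ℂ A := fun b =>
    { carrier := {a | F.coef n (a * b) =
        ∑ k ∈ Finset.Iic n, Φ.α (n - k) (F.coef k a) * F.coef (n - k) b}
      add_mem' := fun {a a'} (ha : _ = _) (ha' : _ = _) => by
        change _ = _
        simp only [add_mul, map_add, hαadd, ha, ha', Finset.sum_add_distrib]
      zero_mem' := by
        change _ = _
        simp only [zero_mul, map_zero, hα0, Finset.sum_const_zero]
      smul_mem' := fun c a (ha : _ = _) => by
        change _ = _
        simp only [smul_mul_assoc, map_smul, hαsmul, ha, Finset.smul_sum] }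
  have hL : ∀ b, IsClosed (L b : Set A) := fun b =>
    isClosed_eq ((F.coef n).continuous.comp (continuous_mul_const b))
      (continuous_finsetSum _ fun k _ =>
        ((Φ.αCLM (n - k)).continuous.comp (F.coef k).continuous).mul continuous_const)
  let R : Submodule ℂ A :=
    { carrier := {b | F.coef n (a * b) =
        ∑ k ∈ Finset.Iic n, Φ.α (n - k) (F.coef k a) * F.coef (n - k) b}
      add_mem' := fun {b b'} (hb : _ = _) (hb' : _ = _) => by
        change _ = _
        simp only [mul_add, map_add, hb, hb', Finset.sum_add_distrib]
      zero_mem' := by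
        change _ = _
        simp only [mul_zero, map_zero, Finset.sum_const_zero]
      smul_mem' := fun c b (hb : _ = _) => by
        change _ = _
        simp only [mul_smul_comm, map_smul, hb, Finset.smul_sum] }
  have hR : IsClosed (R : Set A) :=
    isClosed_eq ((F.coef n).continuous.comp (continuous_const_mul a))
      (continuous_finsetSum _ fun k _ => continuous_const.mul (F.coef (n - k)).continuous)
  refine F.mem_of_mono R hR (fun m g => ?_) b
  refine F.mem_of_mono (L (F.mono m g)) (hL _) (fun l f => ?_) a
  change F.coef n (F.mono l f * F.mono m g) = ∑ k ∈ Finset.Iic n,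
    Φ.α (n - k) (F.coef k (F.mono l f)) * F.coef (n - k) (F.mono m g)
  rw [F.mono_mul, F.coef_mono]
  by_cases h : n = l + m
  · have hnl : n - l = m := by rw [h]; exact add_tsub_cancel_left l m
    rw [if_pos h, Finset.sum_eq_single l]
    · rw [F.coef_mono, F.coef_mono, if_pos rfl, if_pos hnl, hnl]
    · intro k _ hk
      rw [F.coef_mono, if_neg hk, hα0, zero_mul]
    · intro hl
      exact absurd (Finset.mem_Iic.2 (h ▸ le_self_add)) hl
  · rw [if_neg h, Finset.sum_eq_zero]
    intro k hk
    rw [F.coef_mono, F.coef_mono]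
    split_ifs with h2 h3
    · subst h2
      exact absurd (by rw [← h3, add_tsub_cancel_of_le (Finset.mem_Iic.1 hk)]) h
    · rw [mul_zero]
    · rw [hα0, zero_mul]
    · rw [hα0, zero_mul]

/-- Elements all of whose Fourier coefficients are nonnegative functions. -/
def IsPos (a : A) : Prop := ∀ n x, 0 ≤ F.coef n a x

variable {F}

theorem coef_mul_apply (n : Fin d → ℕ) (a b : A) (x : X) :
    F.coef n (a * b) x =
      ∑ k ∈ Finset.Iic n, F.coef k a (Φ.φ (n - k) x) * F.coef (n - k) b x := by
  rw [F.coef_mul]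
  exact map_sum (ZeroAtInftyContinuousMap.evalCLM X x) _ _

theorem IsPos.mul {a b : A} (ha : F.IsPos a) (hb : F.IsPos b) : F.IsPos (a * b) := by
  intro n x
  rw [coef_mul_apply]
  exact Finset.sum_nonneg fun k _ => mul_nonneg (ha _ _) (hb _ _)

/-- For positive elements no cancellation occurs in the convolution. -/
theorem IsPos.mul_coef_le {a b : A} (ha : F.IsPos a) (hb : F.IsPos b) (m n : Fin d → ℕ) (x : X) :
    F.coef m a (Φ.φ n x) * F.coef n b x ≤ F.coef (m + n) (a * b) x := by
  rw [coef_mul_apply]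
  have := Finset.single_le_sum (s := Finset.Iic (m + n))
    (f := fun k => F.coef k a (Φ.φ (m + n - k) x) * F.coef (m + n - k) b x)
    (fun k _ => mul_nonneg (ha _ _) (hb _ _)) (Finset.mem_Iic.2 (le_self_add : m ≤ m + n))
  simpa only [add_tsub_cancel_left] using this

variable (F) [CompleteSpace A]

/-- If `f x ≠ 0` at a recurrent point `x`, then the closed ideal generated by `U_n f` contains an
element with nonnegative coefficients, built from returning times of `x`, that is not
quasi-nilpotent. -/
theorem vanish_of_mono_mem_jacobsonRadical {n : Fin d → ℕ} {f : C₀(X, ℂ)}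
    (hf : F.mono n f ∈ jacobsonRadical A) {x : X}
    (hx : x ∈ Φ.recurrentPts (Function.support n)) : f x = 0 := by
  by_contra hfx
  obtain ⟨g, hg, hg1, -⟩ := ZeroAtInftyContinuousMap.exists_bump
    (isCompact_singleton (x := Φ.φ n x)) isOpen_univ (Set.subset_univ _)
  let c : ℝ := 2 / ‖f x‖ ^ 2
  let f' : C₀(X, ℂ) := f * ((c : ℂ) • star f)
  have hf' : F.mono n f' ∈ jacobsonRadical A := by
    have := (jacobsonRadical_isTwoSidedIdeal (F.mono 0 ((c : ℂ) • star f)) _ hf).2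
    rwa [F.mono_mul, α_zero, add_zero] at this
  have hf'_apply : ∀ y, f' y = ((c * ‖f y‖ ^ 2 : ℝ) : ℂ) := by
    intro y
    have h1 : f y * (starRingEnd ℂ) (f y) = (‖f y‖ : ℂ) ^ 2 := Complex.mul_conj' (f y)
    change f y * ((c : ℂ) * (starRingEnd ℂ) (f y)) = _
    rw [mul_left_comm, h1]
    push_cast
    rfl
  let h : C₀(X, ℂ) := Φ.α n g * f'
  let hr : X → ℝ := fun y => (h y).re
  have hhr : ∀ y, h y = hr y ∧ 0 ≤ hr y := by
    intro y
    obtain ⟨t, ht0, -, ht⟩ := hg (Φ.φ n y)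
    have h1 : h y = ((t * (c * ‖f y‖ ^ 2) : ℝ) : ℂ) := by
      change g (Φ.φ n y) * f' y = _
      rw [ht, hf'_apply, ← Complex.ofReal_mul]
    have h2 : hr y = t * (c * ‖f y‖ ^ 2) := by
      simp only [hr, h1, Complex.ofReal_re]
    rw [h2]
    exact ⟨h1, by positivity⟩
  have hrx : 1 < hr x := by
    have h1 : h x = ((2 : ℝ) : ℂ) := by
      change g (Φ.φ n x) * f' x = _
      rw [hg1 _ rfl, one_mul, hf'_apply]
      congr 1
      have : ‖f x‖ ≠ 0 := norm_ne_zero_iff.2 hfx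
      simp only [c]
      field_simp
    simp only [hr, h1, Complex.ofReal_re]
    norm_num
  obtain ⟨r, s, b, hnr, hs0, hs, hb0, hb, hbnn, hbx⟩ := Φ.exists_dyadic_scheme hx subset_rfl
    (h := hr) (Complex.continuous_re.comp (map_continuous h)) (fun y => (hhr y).2) hrx
  let w : ℕ → ℝ := fun K => (1 / 2) ^ (K + 1)
  have hw0 : ∀ K, 0 ≤ w K := fun K => by positivity
  have hw : Summable w := by
    have := summable_geometric_of_lt_one (r := (1 / 2 : ℝ)) (by norm_num) (by norm_num)
    exact (summable_nat_add_iff 1).2 this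
  have hsum : ∀ (q : ℕ → Fin d → ℕ) (k : C₀(X, ℂ)),
      Summable fun K => (w K : ℂ) • F.mono (q K) k := by
    intro q k
    refine Summable.of_norm_bounded (hw.mul_right ‖k‖) fun K => ?_
    rw [norm_smul, Complex.norm_real, Real.norm_of_nonneg (hw0 K)]
    exact mul_le_mul_of_nonneg_left (F.norm_mono_le _ _) (hw0 K)
  let B : A := ∑' K, (w K : ℂ) • F.mono (r K) h
  have hB : B ∈ jacobsonRadical A := by
    have h1 : B = (∑' K, (w K : ℂ) • F.mono (r K - n) g) * F.mono n f' := by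
      rw [← (hsum _ g).tsum_mul_right]
      refine tsum_congr fun K => ?_
      rw [smul_mul_assoc, F.mono_mul, tsub_add_cancel_of_le (hnr K)]
    rw [h1]
    exact (jacobsonRadical_isTwoSidedIdeal _ _ hf').1
  have hcoef : ∀ m y, HasSum (fun K => (w K : ℂ) * F.coef m (F.mono (r K) h) y) (F.coef m B y) :=
    fun m y => ((hsum r h).hasSum.mapL (F.coef m)).mapL (ZeroAtInftyContinuousMap.evalCLM X y) |>
      fun h1 => by simpa only [map_smul, smul_eq_mul, ZeroAtInftyContinuousMap.evalCLM_apply] using h1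
  have hterm : ∀ m y K, 0 ≤ (w K : ℂ) * F.coef m (F.mono (r K) h) y := by
    intro m y K
    refine mul_nonneg (by exact_mod_cast hw0 K) ?_
    rw [F.coef_mono]
    split_ifs
    · rw [(hhr y).1]
      exact_mod_cast (hhr y).2
    · exact le_rfl
  have hBpos : F.IsPos B := fun m y => (hcoef m y).nonneg (hterm m y)
  have hBr : ∀ K y, ((w K * hr y : ℝ) : ℂ) ≤ F.coef (r K) B y := by
    intro K y
    have h1 := le_hasSum (hcoef (r K) y) K fun K' _ => hterm (r K) y K'
    rwa [F.coef_mono, if_pos rfl, (hhr y).1, ← Complex.ofReal_mul] at h1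
  have key : ∀ K, F.IsPos (dyadicPow B K) ∧ ∀ y, (b K y : ℂ) ≤ F.coef (s K) (dyadicPow B K) y := by
    intro K
    induction K with
    | zero =>
      refine ⟨hBpos, fun y => ?_⟩
      rw [hs0, hb0, dyadicPow]
      simpa only [w, zero_add, pow_one] using hBr 0 y
    | succ K ih =>
      obtain ⟨hpos, hle⟩ := ih
      refine ⟨hpos.mul (hBpos.mul hpos), fun y => ?_⟩
      rw [hs, hb]
      refine le_trans ?_ (hpos.mul_coef_le (hBpos.mul hpos) (s K) (r (K + 1) + s K) y)
      rw [Complex.ofReal_mul]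
      refine mul_le_mul (hle _) ?_ (by
        have h1 := (hhr (Φ.φ (s K) y)).2
        have h2 := hbnn K y
        exact_mod_cast (by positivity)) (hpos _ _)
      refine le_trans ?_ (hBpos.mul_coef_le hpos (r (K + 1)) (s K) y)
      rw [Complex.ofReal_mul]
      exact mul_le_mul (hBr (K + 1) _) (hle y) (by exact_mod_cast hbnn K y) (hBpos _ _)
  obtain ⟨K, hK⟩ := exists_norm_dyadicPow_lt hB (ε := 1 / 16) (by norm_num) (by norm_num)
  have h1 : b K x ≤ ‖dyadicPow B K‖ := by
    have h2 := (Complex.le_def.1 ((key K).2 x)).1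
    rw [Complex.ofReal_re] at h2
    exact h2.trans ((Complex.re_le_norm _).trans
      ((ZeroAtInftyContinuousMap.norm_apply_le_norm _ x).trans (F.norm_coef_le _ _)))
  exact absurd (hK.trans_le ((hbx K).trans h1)) (lt_irrefl _)

end FourierAlgebra

end DynSystem

/-! ### The radicals of the crossed product -/

namespace DynSystem.FourierAlgebra

open AlgRad

variable {d : ℕ} {X : Type*} [TopologicalSpace X] [T2Space X] [LocallyCompactSpace X]
  [TopologicalSpace.MetrizableSpace X] {Φ : DynSystem d X} {A : Type*} [NonUnitalNormedRing A]
  [NormedSpace ℂ A] [IsScalarTower ℂ A A] [SMulCommClass ℂ A A]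
  (F : Φ.FourierAlgebra A)

/-- The monomials `U_n f` of nonzero degree whose coefficient vanishes on the points that are
recurrent in the directions of `n`. -/
def recurrentMonomials : Set A :=
  {a | ∃ n : Fin d → ℕ, n ≠ 0 ∧ ∃ f : C₀(X, ℂ),
    (∀ x ∈ Φ.recurrentPts (Function.support n), f x = 0) ∧ a = F.mono n f}

theorem closedIdealGenerated_le {I : Submodule ℂ A} (hI : IsTwoSidedIdeal I)
    (hc : IsClosed (I : Set A)) (hs : IsSemiprime I) :
    closedIdealGenerated F.recurrentMonomials ≤ I := by
  refine sInf_le ⟨hI, hc, ?_⟩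
  rintro _ ⟨n, -, f, hf, rfl⟩
  exact F.mono_mem_of_vanish_on_recurrentPts hI hc hs n hf

variable [CompleteSpace A]

theorem jacobsonRadical_eq :
    jacobsonRadical A = closedIdealGenerated F.recurrentMonomials := by
  refine le_antisymm (fun a ha => ?_) (F.closedIdealGenerated_le jacobsonRadical_isTwoSidedIdeal
    jacobsonRadical_isClosed jacobsonRadical_isSemiprime)
  have hterm := F.term_mem jacobsonRadical_isClosed
    (fun z a ha => map_mem_jacobsonRadical (F.gauge z) (F.gauge_surjective z) ha) ha
  refine Submodule.mem_sInf.2 fun I hI => F.mem_of_term_mem hI.2.1 fun n => ?_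
  have hv : ∀ x ∈ Φ.recurrentPts (Function.support n), F.coef n a x = 0 := fun x hx =>
    F.vanish_of_mono_mem_jacobsonRadical (hterm n) hx
  by_cases hn : n = 0
  · -- every point is recurrent in the empty set of directions, so the constant term vanishes
    have h0 : F.coef n a = 0 := by
      ext x
      refine hv x ⟨fun _ => 0, fun j hj => absurd hj (by simp [hn]), ?_⟩
      simp only [Φ.φ_zero, id]
      exact tendsto_const_nhds
    rw [term_apply, h0, map_zero]
    exact zero_mem _
  · exact hI.2.2 ⟨n, hn, F.coef n a, hv, rfl⟩

theorem primeRadical_eq_jacobsonRadical_iff (F : Φ.FourierAlgebra A) :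
    primeRadical A = jacobsonRadical A ↔ IsClosed (primeRadical A : Set A) := by
  refine ⟨fun h => h ▸ jacobsonRadical_isClosed, fun h => ?_⟩
  refine le_antisymm primeRadical_le_jacobsonRadical ?_
  rw [F.jacobsonRadical_eq]
  exact F.closedIdealGenerated_le primeRadical_isTwoSidedIdeal h primeRadical_isSemiprime

end DynSystem.FourierAlgebra

theorem theorem3p6 {d : ℕ} {X : Type*} [TopologicalSpace X] [LocallyCompactSpace X]
    [TopologicalSpace.MetrizableSpace X] (Φ : DynSystem d X)
    {H : Type*} [NormedAddCommGroup H] [InnerProductSpace ℂ H] [CompleteSpace H]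
    (ρ : C₀(X, ℂ) →⋆ₙₐ[ℂ] (H →L[ℂ] H)) (hρ : Function.Injective ρ) :
    AlgRad.jacobsonRadical (Φ.crossedProduct ρ) =
        AlgRad.closedIdealGenerated
          {a : Φ.crossedProduct ρ | ∃ n : Fin d → ℕ, n ≠ 0 ∧ ∃ f : C₀(X, ℂ),
            (∀ x ∈ Φ.recurrentPts (Function.support n), f x = 0) ∧ a = Φ.monomial ρ n f} ∧
      (AlgRad.primeRadical (Φ.crossedProduct ρ) = AlgRad.jacobsonRadical (Φ.crossedProduct ρ) ↔
        IsClosed (AlgRad.primeRadical (Φ.crossedProduct ρ) : Set (Φ.crossedProduct ρ))) := by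
  exact ⟨(Φ.fourierAlgebra hρ).jacobsonRadical_eq,
    (Φ.fourierAlgebra hρ).primeRadical_eq_jacobsonRadical_iff⟩
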